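/- Let $\mathbb{T}^2$ be the 7-vertex triangulated torus with vertices $v_1,\dots,v_7$ and triangles $[v_1v_2v_4]$, $[v_2v_4v_5]$, $[v_2v_3v_5]$, $[v_3v_5v_6]$, $[v_1v_5v_6]$, $[v_1v_2v_6]$, $[v_2v_6v_7]$, $[v_2v_3v_7]$, $[v_1v_3v_7]$, $[v_1v_5v_7]$, $[v_4v_5v_7]$, $[v_4v_6v_7]$, $[v_3v_4v_6]$, $[v_1v_3v_4]$, oriented so that $[v_1v_2v_4]$ is positive; it is a triangulation of the closed connected orientable surface of genus $1$. Let $g$ and $i$ be integers with $g\ge 2$ and $1\le i\le g-1$, and let $d$ be an integer with $|d|=g-i$. Then there exist a simplicial complex $K$ with exactly $6g-2i+1$ vertices which triangulates the closed connected orientable surface of genus $g$, a coherent orientation of $K$, and a simplicial map $f\colon K\to\mathbb{T}^2$ of degree $d$, that is, $f_*[K]=d\,[\mathbb{T}^2]$ in $H_2(\mathbb{T}^2;\mathbb{Z})$, where $[K]$ and $[\mathbb{T}^2]$ are the fundamental classes for the chosen orientations. -/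

import Mathlib

namespace TriSurf

open scoped BigOperators

section Surfaces

variable {V : Type*} [Fintype V] [DecidableEq V]

/-- The geometric carrier `‖K‖` of a finite abstract simplicial complex, as a subspace of `ℝ^V`:
the points with non-negative barycentric coordinates of sum `1` whose support spans a face.
It is compact and Hausdorff, since `V` is finite. -/
def carrier (K : AbstractSimplicialComplex V) : Set (V → ℝ) :=
  {x | (∀ v, 0 ≤ x v) ∧ ∑ v, x v = 1 ∧ ∃ s ∈ K.faces, ∀ v, x v ≠ 0 → v ∈ s}

/-- The number `f_k(K)` of `k`-dimensional faces. -/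
noncomputable def faceCount (K : AbstractSimplicialComplex V) (k : ℕ) : ℕ :=
  Set.ncard {s : Finset V | s ∈ K.faces ∧ s.card = k + 1}

/-- `a, b, c` are the three distinct vertices of a `2`-simplex of `K`. -/
def IsTriangle (K : AbstractSimplicialComplex V) (a b c : V) : Prop :=
  a ≠ b ∧ a ≠ c ∧ b ≠ c ∧ ({a, b, c} : Finset V) ∈ K.faces

/-- A coherent orientation of the `2`-simplices of `K`. The number `sign a b c` is `1` if the
ordered triangle `[a b c]` is positively oriented, `-1` if it is negatively oriented, and `0` if
`a, b, c` do not span a triangle. Two triangles that share an edge are oppositely oriented with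
respect to orders which agree on that edge. -/
structure CoherentOrientation (K : AbstractSimplicialComplex V) where
  sign : V → V → V → ℤ
  swap_left : ∀ a b c, sign b a c = - sign a b c
  swap_right : ∀ a b c, sign a c b = - sign a b c
  sign_of_triangle : ∀ a b c, IsTriangle K a b c → sign a b c = 1 ∨ sign a b c = -1
  sign_of_not_triangle : ∀ a b c, ¬ IsTriangle K a b c → sign a b c = 0
  coherent : ∀ a b c c', IsTriangle K a b c → IsTriangle K a b c' → c ≠ c' →
    sign a b c' = - sign a b c

/-- `K` is a triangulation of the closed connected orientable surface `Σ_g` of genus `g`: its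
carrier is a connected topological `2`-manifold without boundary (compact and Hausdorff as a finite
polyhedron), it admits a coherent orientation, and its Euler characteristic is `2 - 2g`. -/
structure IsTriangulatedSurface (K : AbstractSimplicialComplex V) (g : ℕ) : Prop where
  connected : ConnectedSpace (carrier K)
  manifold : Nonempty (ChartedSpace (EuclideanSpace ℝ (Fin 2)) (carrier K))
  orientable : Nonempty (CoherentOrientation K)
  euler : (faceCount K 0 : ℤ) - faceCount K 1 + faceCount K 2 = 2 - 2 * (g : ℤ)

end Surfaces

section Maps

variable {V W : Type*} [Fintype V] [DecidableEq V] [Fintype W] [DecidableEq W]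

/-- The vertex map `f` is simplicial: it sends the vertices of each face of `K` onto the vertices
of a face of `L` (possibly of smaller dimension). -/
def IsSimplicialMap (K : AbstractSimplicialComplex V) (L : AbstractSimplicialComplex W)
    (f : V → W) : Prop :=
  ∀ s ∈ K.faces, s.image f ∈ L.faces

/-- A simplicial `2`-chain with integer coefficients is written as an alternating function `c` of
ordered triples of vertices, `c a b e` being the coefficient of the oriented simplex `[a b e]`.
This is the chain map `f_#`: the coefficient of `[p q r]` in `f_# c` collects those of the oriented
simplices lying over it, and triangles that are collapsed to an edge or a vertex do not contribute
(for `p, q, r` not distinct the sum cancels, as `c` is alternating). -/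
def pushforward (f : V → W) (c : V → V → V → ℤ) (p q r : W) : ℤ :=
  ∑ a, ∑ b, ∑ e, if f a = p ∧ f b = q ∧ f e = r then c a b e else 0

/-- The simplicial map `f` between triangulated closed connected oriented surfaces has degree `d`:
`f_* [K] = d [L]`, where the fundamental class of an oriented triangulated surface is represented by
the sum of its positive minus the sum of its negative triangles, that is, by the `2`-cycle `sign`.
A surface has no `3`-simplices, so `H_2` is the group of `2`-cycles and the equation of homology
classes is one of cycles. -/
def HasDegree {K : AbstractSimplicialComplex V} {L : AbstractSimplicialComplex W}
    (oK : CoherentOrientation K) (oL : CoherentOrientation L) (f : V → W) (d : ℤ) : Prop :=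
  ∀ p q r, pushforward f oK.sign p q r = d * oL.sign p q r

end Maps

/-- The fourteen triangles of the `7`-vertex torus; the vertices `v_1, …, v_7` are written
`0, …, 6`. -/
def torusTriangles : Finset (Finset (Fin 7)) :=
  {{0, 1, 3}, {1, 3, 4}, {1, 2, 4}, {2, 4, 5}, {0, 4, 5}, {0, 1, 5}, {1, 5, 6},
   {1, 2, 6}, {0, 2, 6}, {0, 4, 6}, {3, 4, 6}, {3, 5, 6}, {2, 3, 5}, {0, 2, 3}}

/-- The `7`-vertex triangulated torus. -/
def torus : AbstractSimplicialComplex (Fin 7) where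
  faces := {s | s.Nonempty ∧ ∃ t ∈ torusTriangles, s ⊆ t}
  isRelLowerSet_faces := by
    rintro s ⟨hs, t, ht, hst⟩
    exact ⟨hs, fun u hu hne => ⟨hne, t, ht, hu.trans hst⟩⟩
  singleton_mem := by
    have h : ∀ v : Fin 7, ∃ t ∈ torusTriangles, {v} ⊆ t := by decide
    exact fun v => ⟨Finset.singleton_nonempty v, h v⟩

end TriSurf

/-! Write n = g - i. The surface is built from the torus by connected sums along triangles, each
adding one to the genus. The start is the identity of the 7-vertex torus, of degree 1. A summand has
a triangle lying over (0, 1, 3) with reversed orientation; it is glued to a triangle of the current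
surface lying over (0, 1, 3) positively. The two removed triangles have opposite images, so the map
extends and degrees add (`GlueData.pushCount_glue`).

There are two summands. The mirrored torus, collapsed onto the triangle (0, 1, 3), has degree 0 and
brings 7 - 3 = 4 new vertices. For degree 1 a torus needs a reversed triangle, which the identity
lacks; two extra vertices create one, so 9 - 3 = 6 vertices are new. With n - 1 summands of degree 1
and i of degree 0 the vertex count is 7 + 6(n - 1) + 4i = 6g - 2i + 1. Each summand keeps a positive
triangle for the next one (`IsTorusMap.attach`). Negative degrees come from reversing the
orientation of K.

Surfaces are handled as sets of positively ordered triples, where the axioms are finite conditions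
preserved by gluing (`GlueData.isOrientedSurface`) and decidable for the explicit tori.
`isTriangulatedSurface_complexOf` passes to topology once and for all: a link that is a cycle makes
the open star of its vertex a disc, and counting triples gives the Euler characteristic. -/

namespace TriSurf

open Relation

/-! ### Combinatorial oriented surfaces and their vertex links. -/

/-- A finite set of ordered triples describing the positively oriented triangles of a connected
combinatorial surface: every vertex link is a single oriented cycle. -/
structure IsOrientedSurface {V : Type*} (S : Finset (V × V × V)) : Prop where
  rot : ∀ {a b c}, (a, b, c) ∈ S → (b, c, a) ∈ S
  asymm : ∀ {a b c}, (a, b, c) ∈ S → (b, a, c) ∉ S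
  unique : ∀ {a b c c'}, (a, b, c) ∈ S → (a, b, c') ∈ S → c = c'
  opp : ∀ {a b c}, (a, b, c) ∈ S → ∃ d, (b, a, d) ∈ S
  link : ∀ {v x y x' y'}, (v, x, y) ∈ S → (v, x', y') ∈ S →
    ReflTransGen (fun p q => (v, p, q) ∈ S) x x'
  connected : ∀ {v x y w x' y'}, (v, x, y) ∈ S → (w, x', y') ∈ S →
    ReflTransGen (fun p q => ∃ r, (p, q, r) ∈ S) v w

namespace IsOrientedSurface

variable {V : Type*} {S : Finset (V × V × V)} (h : IsOrientedSurface S)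
include h

theorem ne {a b c : V} (hS : (a, b, c) ∈ S) : a ≠ b ∧ a ≠ c ∧ b ≠ c := by
  have key : ∀ {a b c : V}, (a, b, c) ∈ S → a ≠ b := by
    rintro a b c hS rfl
    exact h.asymm hS hS
  exact ⟨key hS, (key (h.rot (h.rot hS))).symm, key (h.rot hS)⟩

theorem unique_left {v x x' y : V} (h1 : (v, x, y) ∈ S) (h2 : (v, x', y) ∈ S) : x = x' :=
  h.unique (h.rot (h.rot h1)) (h.rot (h.rot h2))

/-- Crossing the edge from v to y leads to the next triangle around v, so link paths never stop. -/
theorem exists_next {v x y : V} (h1 : (v, x, y) ∈ S) : ∃ z, (v, y, z) ∈ S :=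
  h.opp (h.rot (h.rot h1))

/-- The link of a vertex is enumerated cyclically, with period at least three. -/
theorem exists_link_enum {v x y : V} (h1 : (v, x, y) ∈ S) [Finite V] :
    ∃ (m : ℕ) (u : ℕ → V), 3 ≤ m ∧ (∀ n, u (n + m) = u n) ∧ Set.InjOn u (Set.Iio m) ∧
      (∀ n, (v, u n, u (n + 1)) ∈ S) ∧
      ∀ p q, (v, p, q) ∈ S → ∃ n < m, p = u n ∧ q = u (n + 1) := by
  classical
  -- The successor in the link of v, extended by the identity off the link. It is injective on a
  -- finite set, so every orbit is periodic, and u runs through the orbit of x.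
  let σ : V → V := fun p => if hp : ∃ q, (v, p, q) ∈ S then hp.choose else p
  have hσ : ∀ {p q}, (v, p, q) ∈ S → σ p = q := by
    intro p q hpq
    have hp : ∃ q, (v, p, q) ∈ S := ⟨q, hpq⟩
    have : σ p = hp.choose := dif_pos hp
    rw [this]
    exact h.unique (h.rot (h.rot (h.rot hp.choose_spec))) hpq
  have hσn : ∀ {p}, (¬ ∃ q, (v, p, q) ∈ S) → σ p = p := fun hp => dif_neg hp
  have hinj : Function.Injective σ := by
    intro p p' hpp
    by_cases hp : ∃ q, (v, p, q) ∈ S <;> by_cases hp' : ∃ q, (v, p', q) ∈ S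
    · obtain ⟨q, hq⟩ := hp
      obtain ⟨q', hq'⟩ := hp'
      rw [hσ hq, hσ hq'] at hpp
      subst hpp
      exact h.unique_left hq hq'
    · obtain ⟨q, hq⟩ := hp
      rw [hσ hq, hσn hp'] at hpp
      subst hpp
      exact absurd (h.exists_next hq) hp'
    · obtain ⟨q, hq⟩ := hp'
      rw [hσ hq, hσn hp] at hpp
      subst hpp
      exact absurd (h.exists_next hq) hp
    · rwa [hσn hp, hσn hp'] at hpp
  let u : ℕ → V := fun n => σ^[n] x
  have hu : ∀ n, (v, u n, u (n + 1)) ∈ S := by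
    intro n
    induction n with
    | zero => simpa [u, hσ h1] using h1
    | succ n ih =>
      obtain ⟨z, hz⟩ := h.exists_next ih
      have : u (n + 1 + 1) = σ (u (n + 1)) := Function.iterate_succ_apply' σ (n + 1) x
      rw [this, hσ hz]
      exact hz
  have hper : x ∈ Function.periodicPts σ := by
    have := hinj.mem_periodicPts x
    exact this
  have hpos := Function.minimalPeriod_pos_of_mem_periodicPts hper
  set m := Function.minimalPeriod σ x with hm
  have hum : ∀ n, u (n + m) = u n := fun n => by
    simp only [u, hm]
    exact Function.iterate_add_minimalPeriod_eq
  have h0 : u 0 = x := rfl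
  refine ⟨m, u, ?_, hum, Function.iterate_injOn_Iio_minimalPeriod, hu, ?_⟩
  -- Period 1 would give a triangle with a repeated vertex, period 2 a triangle that is positive in
  -- both orders.
  · by_contra hlt
    have h3 : m = 1 ∨ m = 2 := by omega
    rcases h3 with h3 | h3
    · have h4 := hum 0
      rw [h3] at h4
      have := (h.ne (hu 0)).2.2
      simp_all
    · have h4 := hum 0
      rw [h3] at h4
      have h5 := hu 0
      have h6 := hu 1
      simp only [Nat.zero_add, Nat.reduceAdd] at h4 h5 h6
      rw [h4] at h6
      exact h.asymm (h.rot h5) (h.rot h6)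
  · intro p q hpq
    have hreach := h.link h1 hpq
    have : ∃ n, u n = p := by
      clear hpq
      induction hreach with
      | refl => exact ⟨0, rfl⟩
      | tail _ hbc ih =>
        obtain ⟨n, rfl⟩ := ih
        exact ⟨n + 1, h.unique (hu n) hbc⟩
    obtain ⟨n, rfl⟩ := this
    have hmod : u (n % m) = u n := by
      simp only [u, hm]
      exact Function.iterate_mod_minimalPeriod_eq
    refine ⟨n % m, Nat.mod_lt _ hpos, hmod.symm, ?_⟩
    have := hu (n % m)
    rw [hmod] at this
    exact h.unique hpq this

end IsOrientedSurface

/-! ### The complex spanned by the triples, its orientation and its face numbers. -/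

section Complex

variable {V : Type*} [DecidableEq V]

/-- The simplicial complex spanned by a set of triangles that covers all vertices. -/
def complexOf (S : Finset (V × V × V)) (hcov : ∀ v, ∃ x y, (v, x, y) ∈ S) :
    AbstractSimplicialComplex V where
  faces := {s | s.Nonempty ∧ ∃ a b c, (a, b, c) ∈ S ∧ s ⊆ {a, b, c}}
  isRelLowerSet_faces := by
    rintro s ⟨hs, a, b, c, ht, hst⟩
    exact ⟨hs, fun u hu hne => ⟨hne, a, b, c, ht, hu.trans hst⟩⟩
  singleton_mem v := by
    obtain ⟨x, y, hv⟩ := hcov v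
    exact ⟨Finset.singleton_nonempty v, v, x, y, hv, by simp⟩

variable {S : Finset (V × V × V)} {hcov : ∀ v, ∃ x y, (v, x, y) ∈ S}

theorem mem_faces_complexOf {s : Finset V} : s ∈ (complexOf S hcov).faces ↔
    s.Nonempty ∧ ∃ a b c, (a, b, c) ∈ S ∧ s ⊆ {a, b, c} := Iff.rfl

theorem isTriangle_complexOf (h : IsOrientedSurface S) {a b c : V} :
    IsTriangle (complexOf S hcov) a b c ↔ (a, b, c) ∈ S ∨ (b, a, c) ∈ S := by
  constructor
  · rintro ⟨hab, hac, hbc, -, x, y, z, hS, hsub⟩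
    have ha : a ∈ ({x, y, z} : Finset V) := hsub (by simp)
    have hb : b ∈ ({x, y, z} : Finset V) := hsub (by simp)
    have hc : c ∈ ({x, y, z} : Finset V) := hsub (by simp)
    simp only [Finset.mem_insert, Finset.mem_singleton] at ha hb hc
    have h1 := h.rot hS
    have h2 := h.rot h1
    rcases ha with rfl | rfl | rfl <;> rcases hb with rfl | rfl | rfl <;>
      rcases hc with rfl | rfl | rfl <;> simp_all
  · rintro (hS | hS)
    · obtain ⟨h1, h2, h3⟩ := h.ne hS
      exact ⟨h1, h2, h3, by simp, a, b, c, hS, subset_rfl⟩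
    · obtain ⟨h1, h2, h3⟩ := h.ne hS
      exact ⟨h1.symm, h3, h2, by simp, b, a, c, hS, by rw [Finset.insert_comm]⟩

/-- The orientation sign of an ordered triple. -/
def triSign (S : Finset (V × V × V)) (a b c : V) : ℤ :=
  (if (a, b, c) ∈ S then 1 else 0) - (if (b, a, c) ∈ S then 1 else 0)

/-- The orientation in which the given triples are the positive ones. -/
def orientationOf (h : IsOrientedSurface S) : CoherentOrientation (complexOf S hcov) where
  sign := triSign S
  swap_left a b c := by simp [triSign]
  swap_right a b c := by
    have h1 : (a, c, b) ∈ S ↔ (b, a, c) ∈ S := ⟨fun k => h.rot (h.rot k), fun k => h.rot k⟩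
    have h2 : (c, a, b) ∈ S ↔ (a, b, c) ∈ S := ⟨fun k => h.rot k, fun k => h.rot (h.rot k)⟩
    simp [triSign, h1, h2]
  sign_of_triangle a b c ht := by
    rw [isTriangle_complexOf h] at ht
    rcases ht with ht | ht <;> simp [triSign, ht, h.asymm ht]
  sign_of_not_triangle a b c ht := by
    rw [isTriangle_complexOf h, not_or] at ht
    simp [triSign, ht]
  coherent a b c c' ht ht' hne := by
    rw [isTriangle_complexOf h] at ht ht'
    rcases ht with ht | ht <;> rcases ht' with ht' | ht'
    · exact absurd (h.unique ht ht') hne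
    · simp [triSign, ht, ht', h.asymm ht, h.asymm ht']
    · simp [triSign, ht, ht', h.asymm ht, h.asymm ht']
    · exact absurd (h.unique ht ht') hne

section Count

theorem card_eq_mul_card_image {α β : Type*} [DecidableEq β] {s : Finset α} {f : α → β} {k : ℕ}
    (hk : ∀ a ∈ s, (s.filter fun x => f x = f a).card = k) : s.card = k * (s.image f).card := by
  rw [Finset.card_eq_sum_card_image f s, mul_comm, ← smul_eq_mul]
  apply Finset.sum_eq_card_nsmul
  intro b hb
  obtain ⟨a, ha, rfl⟩ := Finset.mem_image.1 hb
  exact hk a ha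

variable (h : IsOrientedSurface S)
include h

theorem card_directed_edges : (S.image fun t => (t.1, t.2.1)).card = S.card := by
  apply Finset.card_image_of_injOn
  rintro ⟨a, b, c⟩ hs ⟨a', b', c'⟩ hs' heq
  simp only [Prod.mk.injEq] at heq
  obtain ⟨rfl, rfl⟩ := heq
  rw [h.unique hs hs']

/-- A triple is determined by its first two entries, so triples correspond to directed edges, and
each edge occurs in both directions. -/
theorem two_mul_faceCount_one : 2 * faceCount (complexOf S hcov) 1 = S.card := by
  set D := S.image fun t => (t.1, t.2.1) with hD
  have hDmem : ∀ {a b}, (a, b) ∈ D ↔ ∃ c, (a, b, c) ∈ S := by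
    intro a b
    simp [hD]
  have hDne : ∀ {a b}, (a, b) ∈ D → a ≠ b := fun k => by
    obtain ⟨c, hc⟩ := hDmem.1 k
    exact (h.ne hc).1
  have hDsw : ∀ {a b}, (a, b) ∈ D → (b, a) ∈ D := fun k => by
    obtain ⟨c, hc⟩ := hDmem.1 k
    exact hDmem.2 (h.opp hc)
  have hset : {s : Finset V | s ∈ (complexOf S hcov).faces ∧ s.card = 1 + 1} =
      ↑(D.image fun e => ({e.1, e.2} : Finset V)) := by
    ext s
    simp only [Set.mem_ofPred_eq, Finset.coe_image, Set.mem_image, Finset.mem_coe, Prod.exists]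
    constructor
    · rintro ⟨⟨-, a, b, c, hS, hsub⟩, hcard⟩
      obtain ⟨x, y, hxy, rfl⟩ := Finset.card_eq_two.1 hcard
      have hx : x ∈ ({a, b, c} : Finset V) := hsub (by simp)
      have hy : y ∈ ({a, b, c} : Finset V) := hsub (by simp)
      simp only [Finset.mem_insert, Finset.mem_singleton] at hx hy
      have h1 := h.rot hS
      have h2 := h.rot h1
      have k1 := hDmem.2 ⟨_, hS⟩
      have k2 := hDmem.2 ⟨_, h1⟩
      have k3 := hDmem.2 ⟨_, h2⟩
      refine ⟨x, y, ?_, rfl⟩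
      rcases hx with rfl | rfl | rfl <;> rcases hy with rfl | rfl | rfl <;>
        first | exact absurd rfl hxy | assumption | (apply hDsw; assumption)
    · rintro ⟨a, b, hab, rfl⟩
      obtain ⟨c, hc⟩ := hDmem.1 hab
      refine ⟨⟨by simp, a, b, c, hc, ?_⟩, Finset.card_pair (hDne hab)⟩
      intro x
      simp only [Finset.mem_insert, Finset.mem_singleton]
      tauto
  rw [faceCount, hset, Set.ncard_coe_finset, ← card_directed_edges h, ← hD]
  refine (card_eq_mul_card_image fun e he => ?_).symm
  obtain ⟨a, b⟩ := e
  have : D.filter (fun x => ({x.1, x.2} : Finset V) = {a, b}) = {(a, b), (b, a)} := by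
    ext ⟨x, y⟩
    simp only [Finset.mem_filter, Finset.mem_insert, Finset.mem_singleton, Prod.mk.injEq]
    constructor
    · rintro ⟨hxy, heq⟩
      have hx : x ∈ ({a, b} : Finset V) := by rw [← heq]; simp
      have hy : y ∈ ({a, b} : Finset V) := by rw [← heq]; simp
      have := hDne hxy
      simp only [Finset.mem_insert, Finset.mem_singleton] at hx hy
      rcases hx with rfl | rfl <;> rcases hy with rfl | rfl <;>
        first
        | exact absurd rfl this
        | exact Or.inl ⟨rfl, rfl⟩
        | exact Or.inr ⟨rfl, rfl⟩
    · rintro (⟨rfl, rfl⟩ | ⟨rfl, rfl⟩)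
      · exact ⟨he, rfl⟩
      · exact ⟨hDsw he, Finset.pair_comm _ _⟩
  rw [this, Finset.card_pair]
  simp [hDne he]

/-- Only the three rotations of a positive triple lie in S; the other three orders are excluded by
`asymm`. -/
theorem three_mul_faceCount_two : 3 * faceCount (complexOf S hcov) 2 = S.card := by
  have hset : {s : Finset V | s ∈ (complexOf S hcov).faces ∧ s.card = 2 + 1} =
      ↑(S.image fun t => ({t.1, t.2.1, t.2.2} : Finset V)) := by
    ext s
    simp only [Set.mem_ofPred_eq, Finset.coe_image, Set.mem_image, Finset.mem_coe, Prod.exists]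
    constructor
    · rintro ⟨⟨-, a, b, c, hS, hsub⟩, hcard⟩
      exact ⟨a, b, c, hS, (Finset.eq_of_subset_of_card_le hsub
        (hcard ▸ Finset.card_le_three)).symm⟩
    · rintro ⟨a, b, c, hS, rfl⟩
      obtain ⟨h1, h2, h3⟩ := h.ne hS
      exact ⟨⟨by simp, a, b, c, hS, subset_rfl⟩, Finset.card_eq_three.2 ⟨a, b, c, h1, h2, h3, rfl⟩⟩
  rw [faceCount, hset, Set.ncard_coe_finset]
  refine (card_eq_mul_card_image fun e he => ?_).symm
  obtain ⟨a, b, c⟩ := e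
  obtain ⟨h1, h2, h3⟩ := h.ne he
  have hr := h.rot he
  have hr' := h.rot hr
  have : S.filter (fun x => ({x.1, x.2.1, x.2.2} : Finset V) = {a, b, c}) =
      {(a, b, c), (b, c, a), (c, a, b)} := by
    ext ⟨x, y, z⟩
    simp only [Finset.mem_filter, Finset.mem_insert, Finset.mem_singleton, Prod.mk.injEq]
    constructor
    · rintro ⟨hxy, heq⟩
      have hx : x ∈ ({a, b, c} : Finset V) := by rw [← heq]; simp
      have hy : y ∈ ({a, b, c} : Finset V) := by rw [← heq]; simp
      have hz : z ∈ ({a, b, c} : Finset V) := by rw [← heq]; simp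
      obtain ⟨k1, k2, k3⟩ := h.ne hxy
      have n1 := h.asymm he
      have n2 := h.asymm hr
      have n3 := h.asymm hr'
      simp only [Finset.mem_insert, Finset.mem_singleton] at hx hy hz
      rcases hx with rfl | rfl | rfl <;> rcases hy with rfl | rfl | rfl <;>
        rcases hz with rfl | rfl | rfl <;>
        first
        | exact absurd rfl k1
        | exact absurd rfl k2
        | exact absurd rfl k3
        | exact absurd hxy n1
        | exact absurd hxy n2
        | exact absurd hxy n3
        | exact Or.inl ⟨rfl, rfl, rfl⟩
        | exact Or.inr (Or.inl ⟨rfl, rfl, rfl⟩)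
        | exact Or.inr (Or.inr ⟨rfl, rfl, rfl⟩)
    · rintro (⟨rfl, rfl, rfl⟩ | ⟨rfl, rfl, rfl⟩ | ⟨rfl, rfl, rfl⟩)
      · exact ⟨he, rfl⟩
      · refine ⟨hr, ?_⟩
        ext
        simp only [Finset.mem_insert, Finset.mem_singleton]
        tauto
      · refine ⟨hr', ?_⟩
        ext
        simp only [Finset.mem_insert, Finset.mem_singleton]
        tauto
  rw [this, Finset.card_eq_three.2 ⟨_, _, _, ?_, ?_, ?_, rfl⟩] <;> simp [h1, h2, h3, h1.symm]

omit h in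
theorem faceCount_zero [Fintype V] : faceCount (complexOf S hcov) 0 = Fintype.card V := by
  have hset : {s : Finset V | s ∈ (complexOf S hcov).faces ∧ s.card = 0 + 1} =
      ↑(Finset.univ.image fun v : V => ({v} : Finset V)) := by
    ext s
    simp only [Set.mem_ofPred_eq, Finset.coe_image, Set.mem_image, Finset.mem_coe,
      Finset.mem_univ, true_and, zero_add, Finset.card_eq_one]
    constructor
    · rintro ⟨-, a, rfl⟩
      exact ⟨a, rfl⟩
    · rintro ⟨a, rfl⟩
      exact ⟨(complexOf S hcov).singleton_mem a, a, rfl⟩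
  rw [faceCount, hset, Set.ncard_coe_finset,
    Finset.card_image_of_injective _ Finset.singleton_injective, Finset.card_univ]

end Count

end Complex

/-! ### Polar coordinates on the disc and on the cone over a cycle. -/

section Cone

/-- The index following `k` in the cyclic order on `{0, …, m - 1}`. -/
def cycSucc (m k : ℕ) : ℕ := if k + 1 = m then 0 else k + 1

/-- Two edge points of the `m`-gon agree: `(k, s)` is the point dividing the edge from vertex `k` to
its successor in the ratio `s : 1 - s`. -/
def SameEdgePoint (m k k' : ℕ) (s s' : ℝ) : Prop :=
  (k = k' ∧ s = s') ∨ (k' = cycSucc m k ∧ s = 1 ∧ s' = 0) ∨ (k = cycSucc m k' ∧ s' = 1 ∧ s = 0)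

/-- The point of the unit disc with radius `r` on the ray of the edge point `(k, s)`. -/
noncomputable def discPoint (m k : ℕ) (s r : ℝ) : ℂ :=
  r * Complex.exp (((2 * Real.pi * ((k + s) / m) : ℝ) : ℂ) * Complex.I)

theorem norm_discPoint (m k : ℕ) (s : ℝ) {r : ℝ} (hr : 0 ≤ r) : ‖discPoint m k s r‖ = r := by
  rw [discPoint, norm_mul, Complex.norm_exp_ofReal_mul_I, mul_one, Complex.norm_real,
    Real.norm_of_nonneg hr]

theorem exp_angle_eq_iff {x y : ℝ} :
    Complex.exp (((2 * Real.pi * x : ℝ) : ℂ) * Complex.I) =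
      Complex.exp (((2 * Real.pi * y : ℝ) : ℂ) * Complex.I) ↔ ∃ n : ℤ, x = y + n := by
  rw [Complex.exp_eq_exp_iff_exists_int]
  refine exists_congr fun n => ?_
  have : ((2 * Real.pi * y : ℝ) : ℂ) * Complex.I + n * (2 * Real.pi * Complex.I) =
      ((2 * Real.pi * (y + n) : ℝ) : ℂ) * Complex.I := by push_cast; ring
  rw [this, mul_left_inj' Complex.I_ne_zero, Complex.ofReal_inj]
  exact mul_right_inj' (by positivity)

/-- Away from the centre the angles agree iff k + s and k' + s' differ by a multiple of m. Together
with `starPoint_eq_iff` this shows that the disc and the closed star are the same quotient of the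
parameter space. -/
theorem discPoint_eq_iff {m k k' : ℕ} (hm : 3 ≤ m) (hk : k < m) (hk' : k' < m) {s s' r r' : ℝ}
    (hs : 0 ≤ s) (hs1 : s ≤ 1) (hs' : 0 ≤ s') (hs1' : s' ≤ 1) (hr : 0 ≤ r) (hr' : 0 ≤ r') :
    discPoint m k s r = discPoint m k' s' r' ↔
      r = r' ∧ (r = 0 ∨ SameEdgePoint m k k' s s') := by
  have hm0 : (0 : ℝ) < m := by exact_mod_cast (by omega : 0 < m)
  have hkR : (k : ℝ) + 1 ≤ m := by exact_mod_cast hk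
  have hkR' : (k' : ℝ) + 1 ≤ m := by exact_mod_cast hk'
  have hk0 : (0 : ℝ) ≤ k := Nat.cast_nonneg k
  have hk0' : (0 : ℝ) ≤ k' := Nat.cast_nonneg k'
  constructor
  · intro heq
    have hrr : r = r' := by
      rw [← norm_discPoint m k s hr, heq, norm_discPoint m k' s' hr']
    refine ⟨hrr, ?_⟩
    subst hrr
    by_cases h0 : r = 0
    · exact Or.inl h0
    right
    rw [discPoint, discPoint, mul_right_inj' (by exact_mod_cast h0), exp_angle_eq_iff] at heq
    obtain ⟨n, hn⟩ := heq
    have hn' : (k : ℝ) + s = k' + s' + n * m := by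
      field_simp at hn
      linarith
    -- Both positions lie in [0, m], so n is -1, 0 or 1; the extreme values occur only when one
    -- position is 0 and the other is m.
    have hn1 : n ≤ 1 := by
      by_contra hlt
      have : (2 : ℝ) ≤ n := by exact_mod_cast (by omega : 2 ≤ n)
      nlinarith
    have hn2 : -1 ≤ n := by
      by_contra hlt
      have : (n : ℝ) ≤ -2 := by exact_mod_cast (by omega : n ≤ -2)
      nlinarith
    unfold SameEdgePoint cycSucc
    interval_cases n
    · push_cast at hn'
      have e1 : (k : ℝ) = 0 := by linarith
      have e2 : (k' : ℝ) + 1 = m := by linarith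
      right; right
      have e2' : k' + 1 = m := by exact_mod_cast e2
      rw [if_pos e2']
      exact ⟨by exact_mod_cast e1, by linarith, by linarith⟩
    · push_cast at hn'
      rcases lt_trichotomy k k' with hlt | rfl | hlt
      · have hl : (k : ℝ) + 1 ≤ k' := by exact_mod_cast hlt
        have e : (k' : ℝ) = k + 1 := by linarith
        right; left
        rw [if_neg (by omega)]
        exact ⟨by exact_mod_cast e, by linarith, by linarith⟩
      · exact Or.inl ⟨rfl, by linarith⟩
      · have hl : (k' : ℝ) + 1 ≤ k := by exact_mod_cast hlt
        have e : (k : ℝ) = k' + 1 := by linarith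
        right; right
        rw [if_neg (by omega)]
        exact ⟨by exact_mod_cast e, by linarith, by linarith⟩
    · push_cast at hn'
      have e1 : (k' : ℝ) = 0 := by linarith
      have e2 : (k : ℝ) + 1 = m := by linarith
      right; left
      have e2' : k + 1 = m := by exact_mod_cast e2
      rw [if_pos e2']
      exact ⟨by exact_mod_cast e1, by linarith, by linarith⟩
  · have key : ∀ k : ℕ, Complex.exp (((2 * Real.pi * ((k + (1 : ℝ)) / m) : ℝ) : ℂ) * Complex.I) =
        Complex.exp (((2 * Real.pi * ((cycSucc m k + (0 : ℝ)) / m) : ℝ) : ℂ) * Complex.I) := by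
      intro k
      rw [exp_angle_eq_iff, cycSucc]
      split_ifs with hkm
      · refine ⟨1, ?_⟩
        rw [← hkm]
        push_cast
        field_simp
        ring
      · refine ⟨0, ?_⟩
        push_cast
        ring
    rintro ⟨rfl, rfl | ⟨rfl, rfl⟩ | ⟨rfl, rfl, rfl⟩ | ⟨rfl, rfl, rfl⟩⟩
    · simp [discPoint]
    · rfl
    · rw [discPoint, discPoint, key]
    · rw [discPoint, discPoint, key]

theorem exists_discPoint_eq {m : ℕ} (hm : 0 < m) (z : ℂ) :
    ∃ k < m, ∃ s : ℝ, 0 ≤ s ∧ s ≤ 1 ∧ discPoint m k s ‖z‖ = z := by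
  have hm0 : (0 : ℝ) < m := by exact_mod_cast hm
  set a := Complex.arg z / (2 * Real.pi) with ha
  have hf0 := Int.fract_nonneg a
  have hf1 := Int.fract_lt_one a
  -- The argument of z rescaled to [0, m): its integer part is the edge and its fractional part the
  -- position on it.
  set t := Int.fract a * m with ht
  have ht0 : 0 ≤ t := by positivity
  have htm : t < m := by nlinarith
  refine ⟨⌊t⌋₊, (Nat.floor_lt ht0).2 htm, t - ⌊t⌋₊, ?_, ?_, ?_⟩
  · linarith [Nat.floor_le ht0]
  · linarith [Nat.lt_floor_add_one t]
  · conv_rhs => rw [← Complex.norm_mul_exp_arg_mul_I z]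
    rw [discPoint]
    congr 1
    have h1 : Complex.arg z = 2 * Real.pi * a := by
      rw [ha]; field_simp
    have h2 : ((⌊t⌋₊ : ℝ) + (t - ⌊t⌋₊)) / m = Int.fract a := by
      rw [add_sub_cancel, ht]; field_simp
    rw [h1, h2, exp_angle_eq_iff]
    exact ⟨-⌊a⌋, by rw [Int.fract]; push_cast; ring⟩

variable {V : Type*} [DecidableEq V]

/-- The point of the closed star of `v` at distance `r` from `v` over the edge point `(k, s)` of the
link cycle `u`, in barycentric coordinates. -/
noncomputable def starPoint (v : V) (u : ℕ → V) (k : ℕ) (s r : ℝ) (w : V) : ℝ :=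
  (if w = v then 1 - r else 0) +
    r * ((if w = u k then 1 - s else 0) + (if w = u (k + 1) then s else 0))

theorem starPoint_apex {v : V} {u : ℕ → V} (hv : ∀ n, u n ≠ v) (k : ℕ) (s r : ℝ) :
    starPoint v u k s r v = 1 - r := by
  simp [starPoint, (hv _).symm]

/-- The coordinate at v determines r; for r nonzero, the coordinates at the two ends of edge k
determine the edge point. -/
theorem starPoint_eq_iff {m k k' : ℕ} (hm : 3 ≤ m) (hk : k < m) (hk' : k' < m) {s s' r r' : ℝ}
    {v : V} {u : ℕ → V} (hv : ∀ n, u n ≠ v) (hper : ∀ n, u (n + m) = u n)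
    (hinj : Set.InjOn u (Set.Iio m)) :
    starPoint v u k s r = starPoint v u k' s' r' ↔
      r = r' ∧ (r = 0 ∨ SameEdgePoint m k k' s s') := by
  have hsucc : ∀ k, u (k + 1) = u (cycSucc m k) := by
    intro k
    unfold cycSucc
    split_ifs with hkm
    · have := hper 0
      rw [hkm, ← this, Nat.zero_add]
    · rfl
  have hlt : ∀ k, k < m → cycSucc m k < m := by
    intro k hk
    unfold cycSucc
    split_ifs <;> omega
  constructor
  · intro heq
    have hrr : r = r' := by
      have := congrFun heq v
      rw [starPoint_apex hv, starPoint_apex hv] at this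
      linarith
    refine ⟨hrr, ?_⟩
    subst hrr
    by_cases h0 : r = 0
    · exact Or.inl h0
    right
    have hu : ∀ i j, i < m → j < m → (u i = u j ↔ i = j) := fun i j hi hj => hinj.eq_iff hi hj
    have hval : ∀ j < m, (if j = k then 1 - s else 0) + (if j = cycSucc m k then s else 0) =
        (if j = k' then 1 - s' else 0) + (if j = cycSucc m k' then s' else 0) := by
      intro j hj
      have := congrFun heq (u j)
      simp only [starPoint, hv, if_false, zero_add, mul_right_inj' h0, hsucc, hu _ _ hj hk,
        hu _ _ hj hk', hu _ _ hj (hlt _ hk), hu _ _ hj (hlt _ hk')] at this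
      exact this
    have v1 := hval k hk
    have v2 := hval _ (hlt k hk)
    have n1 : k ≠ cycSucc m k := by unfold cycSucc; split_ifs <;> omega
    have n2 : k' ≠ cycSucc m k' := by unfold cycSucc; split_ifs <;> omega
    -- This is where m ≥ 3 is needed: in a 2-cycle both edges would have the same ends.
    have n3 : k = cycSucc m k' → cycSucc m k ≠ k' := by
      unfold cycSucc; split_ifs <;> omega
    have n4 : cycSucc m k = cycSucc m k' → k = k' := by
      unfold cycSucc
      intro e
      split_ifs at e <;> omega
    rw [if_pos rfl, if_neg n1] at v1
    rw [if_neg n1.symm, if_pos rfl] at v2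
    unfold SameEdgePoint
    by_cases c1 : k = k'
    · subst c1
      rw [if_pos rfl, if_neg n1] at v1
      exact Or.inl ⟨rfl, by linarith⟩
    · rw [if_neg c1] at v1
      rw [if_neg (fun e => c1 (n4 e))] at v2
      by_cases c2 : k = cycSucc m k'
      · rw [if_pos c2] at v1
        rw [if_neg (n3 c2)] at v2
        exact Or.inr (Or.inr ⟨c2, by linarith, by linarith⟩)
      · rw [if_neg c2] at v1
        by_cases c3 : cycSucc m k = k'
        · rw [if_pos c3] at v2
          exact Or.inr (Or.inl ⟨c3.symm, by linarith, by linarith⟩)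
        · rw [if_neg c3] at v2
          linarith
  · have key : ∀ k, starPoint v u k 1 r = starPoint v u (cycSucc m k) 0 r := by
      intro k
      ext w
      simp [starPoint, hsucc k]
    rintro ⟨rfl, rfl | ⟨rfl, rfl⟩ | ⟨rfl, rfl, rfl⟩ | ⟨rfl, rfl, rfl⟩⟩
    · ext w
      simp [starPoint]
    · rfl
    · rw [key]
    · rw [key]

end Cone

/-- A continuous map out of a compact space factors through a continuous injection of any other
Hausdorff image with the same fibres. -/
theorem exists_isClosedEmbedding_of_fibers {X Y Z : Type*} [TopologicalSpace X] [CompactSpace X]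
    [TopologicalSpace Y] [T2Space Y] [TopologicalSpace Z] [T2Space Z] {f : X → Y} {g : X → Z}
    (hf : Continuous f) (hg : Continuous g) (hsurj : Function.Surjective f)
    (hfib : ∀ x x', f x = f x' ↔ g x = g x') :
    ∃ G : Y → Z, Topology.IsClosedEmbedding G ∧ ∀ x, G (f x) = g x := by
  have hG : ∀ x, g (Function.surjInv hsurj (f x)) = g x := fun x =>
    (hfib _ _).1 (Function.surjInv_eq hsurj (f x))
  have hq : Topology.IsQuotientMap f := hf.isClosedMap.isQuotientMap hf hsurj
  have hY : CompactSpace Y := hsurj.compactSpace hf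
  refine ⟨fun y => g (Function.surjInv hsurj y), ?_, hG⟩
  refine Continuous.isClosedEmbedding (hq.continuous_iff.2 ?_) ?_
  · exact hg.congr fun x => (hG x).symm
  · intro y y' hyy
    have := (hfib _ _).2 hyy
    rwa [Function.surjInv_eq hsurj, Function.surjInv_eq hsurj] at this

theorem nonempty_chartedSpace_of_charts {H M : Type*} [TopologicalSpace H] [TopologicalSpace M]
    (hM : ∀ x : M, ∃ e : OpenPartialHomeomorph M H, x ∈ e.source) :
    Nonempty (ChartedSpace H M) := by
  choose e he using hM
  exact ⟨{ atlas := Set.range e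
           chartAt := e
           mem_chart_source := he
           chart_mem_atlas := fun x => ⟨x, rfl⟩ }⟩

/-! ### The carrier as a closed connected surface. -/

section Carrier

variable {V : Type*} [Fintype V] [DecidableEq V] {S : Finset (V × V × V)}
  {hcov : ∀ v, ∃ x y, (v, x, y) ∈ S}

theorem mem_carrier_of_triple {x : V → ℝ} {a b c : V} (hS : (a, b, c) ∈ S) (h0 : ∀ v, 0 ≤ x v)
    (h1 : ∑ v, x v = 1) (hx : ∀ v, v ≠ a → v ≠ b → v ≠ c → x v = 0) :
    x ∈ carrier (complexOf S hcov) := by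
  refine ⟨h0, h1, {a, b, c}, ⟨by simp, a, b, c, hS, subset_rfl⟩, fun v hv => ?_⟩
  by_contra hn
  simp only [Finset.mem_insert, Finset.mem_singleton, not_or] at hn
  exact hv (hx v hn.1 hn.2.1 hn.2.2)

theorem starPoint_mem_carrier {v : V} {u : ℕ → V}
    (hu : ∀ n, (v, u n, u (n + 1)) ∈ S) (k : ℕ) {s r : ℝ} (hs : 0 ≤ s) (hs1 : s ≤ 1)
    (hr : 0 ≤ r) (hr1 : r ≤ 1) : starPoint v u k s r ∈ carrier (complexOf S hcov) := by
  refine mem_carrier_of_triple (hu k) (fun w => ?_) ?_ (fun w h1 h2 h3 => ?_)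
  · unfold starPoint
    have : 0 ≤ 1 - r := by linarith
    have : 0 ≤ 1 - s := by linarith
    split_ifs <;> positivity
  · simp only [starPoint, Finset.sum_add_distrib, ← Finset.mul_sum, Finset.sum_ite_eq',
      Finset.mem_univ, if_true]
    ring
  · simp [starPoint, h1, h2, h3]

theorem exists_triple_of_carrier (h : IsOrientedSurface S) {x : V → ℝ}
    (hx : x ∈ carrier (complexOf S hcov)) {v : V} (hv : x v ≠ 0) :
    ∃ p q, (v, p, q) ∈ S ∧ ∀ w, w ≠ v → w ≠ p → w ≠ q → x w = 0 := by
  obtain ⟨-, -, s, ⟨-, a, b, c, hS, hsub⟩, hsupp⟩ := hx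
  have hz : ∀ w, w ≠ a → w ≠ b → w ≠ c → x w = 0 := by
    intro w h1 h2 h3
    by_contra hw
    have := hsub (hsupp w hw)
    simp_all
  have hv' := hsub (hsupp v hv)
  simp only [Finset.mem_insert, Finset.mem_singleton] at hv'
  have h1 := h.rot hS
  have h2 := h.rot h1
  rcases hv' with rfl | rfl | rfl
  · exact ⟨b, c, hS, hz⟩
  · exact ⟨c, a, h1, fun w k1 k2 k3 => hz w k3 k1 k2⟩
  · exact ⟨a, b, h2, fun w k1 k2 k3 => hz w k2 k3 k1⟩

theorem exists_starPoint_eq (h : IsOrientedSurface S) {v : V} {u : ℕ → V} {m : ℕ}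
    (hlink : ∀ p q, (v, p, q) ∈ S → ∃ n < m, p = u n ∧ q = u (n + 1))
    {x : V → ℝ} (hx : x ∈ carrier (complexOf S hcov)) (hv : 0 < x v) :
    ∃ k < m, ∃ s r : ℝ, 0 ≤ s ∧ s ≤ 1 ∧ 0 ≤ r ∧ r ≤ 1 ∧ starPoint v u k s r = x := by
  obtain ⟨p, q, hS, hz⟩ := exists_triple_of_carrier h hx hv.ne'
  obtain ⟨hvp, hvq, hpq⟩ := h.ne hS
  obtain ⟨n, hn, hp, hq⟩ := hlink p q hS
  obtain ⟨h0, h1, -⟩ := hx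
  have hsum : x v + x p + x q = 1 := by
    rw [← h1, ← Finset.sum_subset (Finset.subset_univ ({v, p, q} : Finset V))]
    · rw [Finset.sum_insert (by simp [hvp, hvq]), Finset.sum_pair hpq]
      ring
    · intro w _ hw
      simp only [Finset.mem_insert, Finset.mem_singleton, not_or] at hw
      exact hz w hw.1 hw.2.1 hw.2.2
  have hp0 := h0 p
  have hq0 := h0 q
  set r := 1 - x v with hr
  have hr0 : 0 ≤ r := by linarith
  -- At the vertex itself r = 0 and the quotient is 0 by convention; this is harmless since then x q
  -- = 0.
  have hmul : r * (x q / r) = x q := by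
    rcases hr0.eq_or_lt with h2 | h2
    · rw [← h2, zero_mul]; linarith
    · field_simp
  refine ⟨n, hn, x q / r, r, by positivity, div_le_one_of_le₀ (by linarith) hr0, hr0,
    by linarith, ?_⟩
  have hmul' : r * (1 - x q / r) = x p := by rw [mul_sub, hmul]; linarith
  ext w
  rw [starPoint, ← hp, ← hq, mul_add, mul_ite, mul_ite, hmul, hmul', mul_zero]
  by_cases c1 : w = v
  · subst c1
    simp [hvp, hvq, hr]
  by_cases c2 : w = p
  · subst c2
    simp [c1, hpq]
  by_cases c3 : w = q
  · subst c3
    simp [c1, c2]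
  · simp [c1, c2, c3, hz w c1 c2 c3]

/-- The open star of a vertex is a coordinate neighbourhood. -/
theorem exists_star_chart (h : IsOrientedSurface S) (v : V) :
    ∃ e : OpenPartialHomeomorph (carrier (complexOf S hcov)) (EuclideanSpace ℝ (Fin 2)),
      e.source = {x | 0 < x.1 v} := by
  obtain ⟨p, q, hpq⟩ := hcov v
  obtain ⟨m, u, hm, hper, hinj, hu, hlink⟩ := h.exists_link_enum hpq
  have hv : ∀ n, u n ≠ v := fun n => (h.ne (hu n)).1.symm
  -- The compact parameter space maps onto the closed disc and into the star with the same fibres.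
  -- The resulting embedding of the closed disc takes the open disc onto the open star, as the
  -- coordinate at v is 1 - r.
  let X := Fin m × unitInterval × unitInterval
  let f : X → Metric.closedBall (0 : ℂ) 1 := fun x =>
    ⟨discPoint m x.1 x.2.1 x.2.2, by
      rw [mem_closedBall_zero_iff, norm_discPoint _ _ _ x.2.2.2.1]
      exact x.2.2.2.2⟩
  let g : X → carrier (complexOf S hcov) := fun x =>
    ⟨starPoint v u x.1 x.2.1 x.2.2,
      starPoint_mem_carrier hu _ x.2.1.2.1 x.2.1.2.2 x.2.2.2.1 x.2.2.2.2⟩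
  have hf : Continuous f := by
    refine Continuous.subtype_mk ?_ _
    rw [continuous_prod_of_discrete_left]
    intro k
    unfold discPoint
    fun_prop
  have hg : Continuous g := by
    refine Continuous.subtype_mk ?_ _
    rw [continuous_prod_of_discrete_left]
    intro k
    refine continuous_pi fun w => ?_
    simp only [starPoint]
    split_ifs <;> fun_prop
  have hsurj : Function.Surjective f := by
    rintro ⟨z, hz⟩
    rw [mem_closedBall_zero_iff] at hz
    obtain ⟨k, hk, s, hs, hs1, hzs⟩ := exists_discPoint_eq (by omega : 0 < m) z
    exact ⟨(⟨k, hk⟩, ⟨s, hs, hs1⟩, ⟨‖z‖, norm_nonneg z, hz⟩), Subtype.ext hzs⟩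
  have hfib : ∀ x x', f x = f x' ↔ g x = g x' := by
    intro x x'
    rw [Subtype.ext_iff, Subtype.ext_iff]
    exact (discPoint_eq_iff hm x.1.2 x'.1.2 x.2.1.2.1 x.2.1.2.2 x'.2.1.2.1 x'.2.1.2.2
      x.2.2.2.1 x'.2.2.2.1).trans (starPoint_eq_iff hm x.1.2 x'.1.2 hv hper hinj).symm
  obtain ⟨G, hG, hGf⟩ := exists_isClosedEmbedding_of_fibers hf hg hsurj hfib
  have hGv : ∀ z, (G z).1 v = 1 - ‖(z : ℂ)‖ := by
    intro z
    obtain ⟨x, rfl⟩ := hsurj z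
    rw [hGf]
    change starPoint v u x.1 x.2.1 x.2.2 v = 1 - ‖discPoint m x.1 x.2.1 x.2.2‖
    rw [starPoint_apex hv, norm_discPoint _ _ _ x.2.2.2.1]
  let j : Metric.ball (0 : ℂ) 1 → carrier (complexOf S hcov) :=
    G ∘ Set.inclusion Metric.ball_subset_closedBall
  have hrange : Set.range j = {x | 0 < x.1 v} := by
    ext x
    constructor
    · rintro ⟨z, rfl⟩
      have := z.2
      rw [mem_ball_zero_iff] at this
      change 0 < (G _).1 v
      rw [hGv]
      simpa using this
    · intro hx
      obtain ⟨k, hk, s, r, hs, hs1, hr, hr1, hxs⟩ := exists_starPoint_eq h hlink x.2 hx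
      have hgx : g (⟨k, hk⟩, ⟨s, hs, hs1⟩, ⟨r, hr, hr1⟩) = x := Subtype.ext hxs
      rw [← hGf] at hgx
      have hlt : ‖(f (⟨k, hk⟩, ⟨s, hs, hs1⟩, ⟨r, hr, hr1⟩) : ℂ)‖ < 1 := by
        have hx' : 0 < x.1 v := hx
        rw [← hgx, hGv] at hx'
        linarith
      exact ⟨⟨_, mem_ball_zero_iff.2 hlt⟩, hgx⟩
  have hopen : IsOpen {x : carrier (complexOf S hcov) | 0 < x.1 v} :=
    isOpen_lt continuous_const ((continuous_apply v).comp continuous_subtype_val)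
  have hj : Topology.IsOpenEmbedding j :=
    ⟨hG.isEmbedding.comp (Topology.IsEmbedding.inclusion _), hrange ▸ hopen⟩
  have hb : Topology.IsOpenEmbedding (Subtype.val : Metric.ball (0 : ℂ) 1 → ℂ) :=
    Metric.isOpen_ball.isOpenEmbedding_subtypeVal
  have : Nonempty (Metric.ball (0 : ℂ) 1) := ⟨⟨0, by simp⟩⟩
  refine ⟨((hj.toOpenPartialHomeomorph j).symm.trans
    (hb.toOpenPartialHomeomorph Subtype.val)).transHomeomorph
      Complex.orthonormalBasisOneI.repr.toHomeomorph, ?_⟩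
  simp [hrange]

omit [DecidableEq V] in
theorem exists_pos_of_mem_carrier {K : AbstractSimplicialComplex V} {x : V → ℝ}
    (hx : x ∈ carrier K) : ∃ v, 0 < x v := by
  by_contra! hn
  have := hx.2.1
  rw [Finset.sum_eq_zero fun v _ => le_antisymm (hn v) (hx.1 v)] at this
  exact zero_ne_one this

theorem nonempty_chartedSpace_carrier (h : IsOrientedSurface S) :
    Nonempty (ChartedSpace (EuclideanSpace ℝ (Fin 2)) (carrier (complexOf S hcov))) := by
  refine nonempty_chartedSpace_of_charts fun x => ?_
  obtain ⟨v, hv⟩ := exists_pos_of_mem_carrier x.2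
  obtain ⟨e, he⟩ := exists_star_chart (hcov := hcov) h v
  exact ⟨e, he ▸ hv⟩

/-- A face is convex, so the segment between two of its points stays in the carrier. -/
theorem joinedIn_carrier {K : AbstractSimplicialComplex V} {s : Finset V} (hs : s ∈ K.faces)
    {x y : V → ℝ} (hx : x ∈ stdSimplex ℝ V) (hy : y ∈ stdSimplex ℝ V)
    (hxs : ∀ v, x v ≠ 0 → v ∈ s) (hys : ∀ v, y v ≠ 0 → v ∈ s) : JoinedIn (carrier K) x y := by
  refine JoinedIn.of_segment_subset fun z hz => ?_
  have hz' := (convex_stdSimplex ℝ V).segment_subset hx hy hz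
  refine ⟨hz'.1, hz'.2, s, hs, fun v hv => ?_⟩
  obtain ⟨a, b, -, -, -, rfl⟩ := hz
  by_contra hn
  have h1 : x v = 0 := by_contra fun k => hn (hxs v k)
  have h2 : y v = 0 := by_contra fun k => hn (hys v k)
  simp [h1, h2] at hv

theorem connectedSpace_carrier [Nonempty V] (h : IsOrientedSurface S) :
    ConnectedSpace (carrier (complexOf S hcov)) := by
  have hsv : ∀ v, ∀ w, (Pi.single v 1 : V → ℝ) w ≠ 0 → w = v := by
    intro v w hw
    by_contra hn
    simp [hn] at hw
  have hedge : ∀ v w, (∃ r, (v, w, r) ∈ S) →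
      JoinedIn (carrier (complexOf S hcov)) (Pi.single v 1) (Pi.single w 1) := by
    rintro v w ⟨r, hr⟩
    refine joinedIn_carrier (s := {v, w, r})
      (mem_faces_complexOf.2 ⟨by simp, v, w, r, hr, subset_rfl⟩)
      (single_mem_stdSimplex ℝ v) (single_mem_stdSimplex ℝ w) ?_ ?_
    · intro x hx; simp [hsv v x hx]
    · intro x hx; simp [hsv w x hx]
  have hmem : ∀ v, (Pi.single v 1 : V → ℝ) ∈ carrier (complexOf S hcov) := by
    intro v
    obtain ⟨x, y, hv⟩ := hcov v
    exact (hedge v x ⟨y, hv⟩).source_mem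
  have hvert : ∀ v w, JoinedIn (carrier (complexOf S hcov)) (Pi.single v 1) (Pi.single w 1) := by
    intro v w
    obtain ⟨x, y, hv⟩ := hcov v
    obtain ⟨x', y', hw⟩ := hcov w
    have hreach := h.connected hv hw
    clear hw
    induction hreach with
    | refl => exact JoinedIn.refl (hmem v)
    | tail _ hbc ih =>
      exact ih.trans (hedge _ _ hbc)
  rw [← isConnected_iff_connectedSpace]
  refine IsPathConnected.isConnected ?_
  obtain ⟨v₀⟩ := ‹Nonempty V›
  refine ⟨Pi.single v₀ 1, hmem v₀, fun {x} hx => ?_⟩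
  obtain ⟨v, hv⟩ := exists_pos_of_mem_carrier hx
  obtain ⟨h0, h1, s, hs, hsupp⟩ := hx
  refine (hvert v₀ v).trans (joinedIn_carrier hs (single_mem_stdSimplex ℝ v) ⟨h0, h1⟩ ?_ hsupp)
  intro w hw
  rw [hsv v w hw]
  exact hsupp v hv.ne'

/-- With N = |V| + 2g - 2 and 6N triples there are 3N edges and 2N triangles, so the Euler
characteristic is |V| - N = 2 - 2g. -/
theorem isTriangulatedSurface_complexOf (h : IsOrientedSurface S) [Nonempty V] {g : ℕ}
    (hcard : (S.card : ℤ) = 6 * (Fintype.card V + 2 * g - 2)) :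
    IsTriangulatedSurface (complexOf S hcov) g where
  connected := connectedSpace_carrier h
  manifold := nonempty_chartedSpace_carrier h
  orientable := ⟨orientationOf h⟩
  euler := by
    have h1 := two_mul_faceCount_one (hcov := hcov) h
    have h2 := three_mul_faceCount_two (hcov := hcov) h
    have h0 := faceCount_zero (hcov := hcov)
    omega

end Carrier

/-! ### Connected sums along a triangle. -/

/-- Whenever the path uses the edge from a to b it is back at its start b, and everything before can
be dropped. -/
theorem reflTransGen_avoid {α : Type*} {r : α → α → Prop} {a b x : α} (h : ReflTransGen r b x) :
    ReflTransGen (fun p q => r p q ∧ ¬ (p = a ∧ q = b)) b x := by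
  induction h with
  | refl => exact ReflTransGen.refl
  | @tail p q _ hpq ih =>
    by_cases hc : p = a ∧ q = b
    · rw [hc.2]
    · exact ih.tail ⟨hpq, hc⟩

/-- A path to a that is about to use the edge from a to b has already arrived. -/
theorem reflTransGen_avoid' {α : Type*} {r : α → α → Prop} {a b x : α} (h : ReflTransGen r x a) :
    ReflTransGen (fun p q => r p q ∧ ¬ (p = a ∧ q = b)) x a := by
  induction h using ReflTransGen.head_induction_on with
  | refl => exact ReflTransGen.refl
  | @head p q hpq _ ih =>
    by_cases hc : p = a ∧ q = b
    · rw [hc.1]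
    · exact ih.head ⟨hpq, hc⟩

section Glue

variable {V W : Type*} [DecidableEq V] [DecidableEq W]

/-- The three rotations of an ordered triple. -/
def triRot (a b c : V) : Finset (V × V × V) := {(a, b, c), (b, c, a), (c, a, b)}

theorem mem_triRot {a b c x y z : V} : (x, y, z) ∈ triRot a b c ↔
    (x = a ∧ y = b ∧ z = c) ∨ (x = b ∧ y = c ∧ z = a) ∨ (x = c ∧ y = a ∧ z = b) := by
  simp [triRot]

/-- The connected sum along a triangle that is `(a, b, c)` in `S` and `(b, a, c)` in `T`. -/
def glue (S T : Finset (V × V × V)) (a b c : V) : Finset (V × V × V) :=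
  (S \ triRot a b c) ∪ (T \ triRot b a c)

theorem mem_glue {S T : Finset (V × V × V)} {a b c : V} {t : V × V × V} : t ∈ glue S T a b c ↔
    (t ∈ S ∧ t ∉ triRot a b c) ∨ (t ∈ T ∧ t ∉ triRot b a c) := by
  simp [glue]

/-- The image of a set of triples under a vertex map. -/
def mapTriples (j : W → V) (T : Finset (W × W × W)) : Finset (V × V × V) :=
  T.image fun t => (j t.1, j t.2.1, j t.2.2)

omit [DecidableEq W] in
theorem mem_mapTriples {j : W → V} {T : Finset (W × W × W)} {x y z : V} :
    (x, y, z) ∈ mapTriples j T ↔ ∃ a b c, (a, b, c) ∈ T ∧ j a = x ∧ j b = y ∧ j c = z := by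
  simp [mapTriples]

omit [DecidableEq W] in
theorem mem_mapTriples_of_mem {j : W → V} {T : Finset (W × W × W)} {a b c : W}
    (h : (a, b, c) ∈ T) : (j a, j b, j c) ∈ mapTriples j T :=
  mem_mapTriples.2 ⟨a, b, c, h, rfl, rfl, rfl⟩

omit [DecidableEq W] in
theorem mem_mapTriples_iff {j : W → V} (hj : Function.Injective j) {T : Finset (W × W × W)}
    {a b c : W} : (j a, j b, j c) ∈ mapTriples j T ↔ (a, b, c) ∈ T := by
  refine ⟨fun h => ?_, mem_mapTriples_of_mem⟩
  obtain ⟨a', b', c', h, h1, h2, h3⟩ := mem_mapTriples.1 h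
  rwa [← hj h1, ← hj h2, ← hj h3]

omit [DecidableEq V] [DecidableEq W] in
theorem injective_mapTriple {j : W → V} (hj : Function.Injective j) :
    Function.Injective fun t : W × W × W => (j t.1, j t.2.1, j t.2.2) := by
  rintro ⟨a, b, c⟩ ⟨a', b', c'⟩ heq
  simp only [Prod.mk.injEq] at heq
  rw [hj heq.1, hj heq.2.1, hj heq.2.2]

omit [DecidableEq W] in
theorem IsOrientedSurface.map {j : W → V} (hj : Function.Injective j) {T : Finset (W × W × W)}
    (h : IsOrientedSurface T) : IsOrientedSurface (mapTriples j T) where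
  rot {x y z} hS := by
    obtain ⟨a, b, c, hT, rfl, rfl, rfl⟩ := mem_mapTriples.1 hS
    exact mem_mapTriples_of_mem (h.rot hT)
  asymm {x y z} hS := by
    obtain ⟨a, b, c, hT, rfl, rfl, rfl⟩ := mem_mapTriples.1 hS
    rw [mem_mapTriples_iff hj]
    exact h.asymm hT
  unique {x y z z'} hS hS' := by
    obtain ⟨a, b, c, hT, rfl, rfl, rfl⟩ := mem_mapTriples.1 hS
    obtain ⟨a', b', c', hT', h1, h2, rfl⟩ := mem_mapTriples.1 hS'
    rw [hj h1, hj h2] at hT'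
    rw [h.unique hT hT']
  opp {x y z} hS := by
    obtain ⟨a, b, c, hT, rfl, rfl, rfl⟩ := mem_mapTriples.1 hS
    obtain ⟨d, hd⟩ := h.opp hT
    exact ⟨j d, mem_mapTriples_of_mem hd⟩
  link {v x y x' y'} hS hS' := by
    obtain ⟨a, b, c, hT, rfl, rfl, rfl⟩ := mem_mapTriples.1 hS
    obtain ⟨a', b', c', hT', h1, rfl, rfl⟩ := mem_mapTriples.1 hS'
    rw [hj h1] at hT'
    exact ReflTransGen.lift j (fun p q hpq => mem_mapTriples_of_mem hpq) _ _ (h.link hT hT')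
  connected {v x y w x' y'} hS hS' := by
    obtain ⟨a, b, c, hT, rfl, rfl, rfl⟩ := mem_mapTriples.1 hS
    obtain ⟨a', b', c', hT', rfl, rfl, rfl⟩ := mem_mapTriples.1 hS'
    exact ReflTransGen.lift j (fun p q ⟨r, hpq⟩ => ⟨j r, mem_mapTriples_of_mem hpq⟩) _ _
      (h.connected hT hT')

theorem triRot_subset {S : Finset (V × V × V)} (h : IsOrientedSurface S) {a b c : V}
    (hS : (a, b, c) ∈ S) : triRot a b c ⊆ S := by
  rintro ⟨x, y, z⟩ ht
  rcases mem_triRot.1 ht with ⟨rfl, rfl, rfl⟩ | ⟨rfl, rfl, rfl⟩ | ⟨rfl, rfl, rfl⟩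
  · exact hS
  · exact h.rot hS
  · exact h.rot (h.rot hS)

/-- A positive triangle on the vertices of a given positive triangle is one of its rotations. -/
theorem mem_triRot_of_mem {S : Finset (V × V × V)} (h : IsOrientedSurface S) {a b c x y z : V}
    (hS : (a, b, c) ∈ S) (hx : (x, y, z) ∈ S) (h1 : x = a ∨ x = b ∨ x = c)
    (h2 : y = a ∨ y = b ∨ y = c) (h3 : z = a ∨ z = b ∨ z = c) : (x, y, z) ∈ triRot a b c := by
  obtain ⟨k1, k2, k3⟩ := h.ne hx
  have n1 := h.asymm hS
  have n2 := h.asymm (h.rot hS)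
  have n3 := h.asymm (h.rot (h.rot hS))
  rw [mem_triRot]
  rcases h1 with rfl | rfl | rfl <;> rcases h2 with rfl | rfl | rfl <;>
    rcases h3 with rfl | rfl | rfl <;>
    first
    | exact absurd rfl k1
    | exact absurd rfl k2
    | exact absurd rfl k3
    | exact absurd hx n1
    | exact absurd hx n2
    | exact absurd hx n3
    | exact Or.inl ⟨rfl, rfl, rfl⟩
    | exact Or.inr (Or.inl ⟨rfl, rfl, rfl⟩)
    | exact Or.inr (Or.inr ⟨rfl, rfl, rfl⟩)

theorem triRot_rot {a b c x y z : V} : (y, z, x) ∈ triRot a b c ↔ (x, y, z) ∈ triRot a b c := by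
  simp only [mem_triRot]
  tauto

theorem triRot_swap {a b c x y z : V} : (y, x, z) ∈ triRot b a c ↔ (x, y, z) ∈ triRot a b c := by
  simp only [mem_triRot]
  tauto

/-- The hypotheses of a connected sum along a triangle. -/
structure GlueData (S T : Finset (V × V × V)) (a b c : V) : Prop where
  left : IsOrientedSurface S
  right : IsOrientedSurface T
  mem_left : (a, b, c) ∈ S
  mem_right : (b, a, c) ∈ T
  inter : ∀ {v x y x' y'}, (v, x, y) ∈ S → (v, x', y') ∈ T → v = a ∨ v = b ∨ v = c

namespace GlueData

variable {S T : Finset (V × V × V)} {a b c : V} (h : GlueData S T a b c)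
include h

omit [DecidableEq V] in
theorem symm : GlueData T S b a c where
  left := h.right
  right := h.left
  mem_left := h.mem_right
  mem_right := h.mem_left
  inter h1 h2 := by
    have := h.inter h2 h1
    tauto

omit h in
theorem glue_comm : glue T S b a c = glue S T a b c := Finset.union_comm _ _

omit [DecidableEq V] in
-- With `symm`, this reduces the axioms for the glued surface to the side S and the apex a.
theorem rotate : GlueData S T b c a where
  left := h.left
  right := h.right
  mem_left := h.left.rot h.mem_left
  mem_right := h.right.rot (h.right.rot h.mem_right)
  inter h1 h2 := by
    have := h.inter h1 h2
    tauto

omit h in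
theorem glue_rotate : glue S T b c a = glue S T a b c := by
  ext ⟨x, y, z⟩
  simp only [mem_glue, mem_triRot]
  tauto

/-- Both ends of a common directed edge lie in {a, b, c}. If it runs along (a, b, c), its triangle
in S is the removed one; otherwise its triangle in T is. -/
theorem inter_two {x y z z' : V} (hS : (x, y, z) ∈ S) (hT : (x, y, z') ∈ T) :
    (x, y, z) ∈ triRot a b c ∨ (x, y, z') ∈ triRot b a c := by
  have h1 := h.inter hS hT
  have h2 := h.inter (h.left.rot hS) (h.right.rot hT)
  have hxy := (h.left.ne hS).1
  have e1 := h.mem_left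
  have e2 := h.left.rot e1
  have e3 := h.left.rot e2
  have f1 := h.mem_right
  have f2 := h.right.rot f1
  have f3 := h.right.rot f2
  simp only [mem_triRot]
  rcases h1 with rfl | rfl | rfl <;> rcases h2 with rfl | rfl | rfl
  · exact absurd rfl hxy
  · simp [h.left.unique hS e1]
  · simp [h.right.unique hT f2]
  · simp [h.right.unique hT f1]
  · exact absurd rfl hxy
  · simp [h.left.unique hS e2]
  · simp [h.left.unique hS e3]
  · simp [h.right.unique hT f3]
  · exact absurd rfl hxy

theorem not_mem_swap {x y z : V} (hS : (x, y, z) ∈ S) (hn : (x, y, z) ∉ triRot a b c) :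
    (y, x, z) ∉ T := by
  intro hT
  have h1 := h.inter hS (h.right.rot hT)
  have h2 := h.inter (h.left.rot hS) hT
  have h3 := h.inter (h.left.rot (h.left.rot hS)) (h.right.rot (h.right.rot hT))
  exact hn (mem_triRot_of_mem h.left h.mem_left hS h1 h2 h3)

/-- If the neighbour across the edge was removed from S, the triangle of T beyond the removed one
takes its place. -/
theorem opp_left {x y z : V} (hS : (x, y, z) ∈ S) :
    ∃ d, (y, x, d) ∈ glue S T a b c := by
  obtain ⟨d, hd⟩ := h.left.opp hS
  by_cases hm : (y, x, d) ∈ triRot a b c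
  · have hT : (x, y, d) ∈ T := triRot_subset h.right h.mem_right (triRot_swap.2 hm)
    obtain ⟨e, he⟩ := h.right.opp hT
    refine ⟨e, mem_glue.2 (Or.inr ⟨he, fun hm' => ?_⟩)⟩
    obtain ⟨h1, h2, h3⟩ := h.left.ne h.mem_left
    rw [mem_triRot] at hm hm'
    grind
  · exact ⟨d, mem_glue.2 (Or.inl ⟨hd, hm⟩)⟩

/-- No edge is lost: an edge of the removed triangle still bounds a triangle of T. -/
theorem adj_of_left {x y z : V} (hS : (x, y, z) ∈ S) : ∃ d, (x, y, d) ∈ glue S T a b c := by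
  by_cases hn : (x, y, z) ∈ triRot a b c
  · have hT : (y, x, z) ∈ T := triRot_subset h.right h.mem_right (triRot_swap.2 hn)
    obtain ⟨e, he⟩ := h.right.opp hT
    by_cases hm : (x, y, e) ∈ triRot b a c
    · obtain ⟨h1, h2, h3⟩ := h.left.ne h.mem_left
      rw [mem_triRot] at hm hn
      grind
    · exact ⟨e, mem_glue.2 (Or.inr ⟨he, hm⟩)⟩
  · exact ⟨z, mem_glue.2 (Or.inl ⟨hS, hn⟩)⟩

theorem reach_left {v w x y x' y' : V} (hv : (v, x, y) ∈ S) (hw : (w, x', y') ∈ S) :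
    ReflTransGen (fun p q => ∃ r, (p, q, r) ∈ glue S T a b c) v w :=
  ReflTransGen.mono (fun _ _ ⟨_, hr⟩ => h.adj_of_left hr) _ _ (h.left.connected hv hw)

theorem reach_right {v w x y x' y' : V} (hv : (v, x, y) ∈ T) (hw : (w, x', y') ∈ T) :
    ReflTransGen (fun p q => ∃ r, (p, q, r) ∈ glue S T a b c) v w := by
  rw [← glue_comm]
  exact h.symm.reach_left hv hw

/-- In the link of `a`, the oriented link path of `S` without the edge from `b` to `c`. -/
theorem link_left_mono {p q : V} (hpq : (a, p, q) ∈ S ∧ ¬ (p = b ∧ q = c)) :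
    (a, p, q) ∈ glue S T a b c := by
  refine mem_glue.2 (Or.inl ⟨hpq.1, fun hm => ?_⟩)
  obtain ⟨h1, h2, h3⟩ := h.left.ne h.mem_left
  rw [mem_triRot] at hm
  grind

/-- Removing the edge from b to c opens the link cycle of a in S into a path from c to b through all
its vertices. -/
theorem link_apex_left {x y : V} (hx : (a, x, y) ∈ S) :
    ReflTransGen (fun p q => (a, p, q) ∈ glue S T a b c) x b ∧
      ReflTransGen (fun p q => (a, p, q) ∈ glue S T a b c) c x := by
  obtain ⟨z, hz⟩ := h.left.exists_next h.mem_left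
  have mono : (fun p q => (a, p, q) ∈ S ∧ ¬ (p = b ∧ q = c)) ≤
      (fun p q => (a, p, q) ∈ glue S T a b c) := fun p q hpq => h.link_left_mono hpq
  exact ⟨ReflTransGen.mono mono _ _ (reflTransGen_avoid' (h.left.link hx h.mem_left)),
    ReflTransGen.mono mono _ _ (reflTransGen_avoid (h.left.link hz hx))⟩

theorem link_apex_right {x y : V} (hx : (a, x, y) ∈ T) :
    ReflTransGen (fun p q => (a, p, q) ∈ glue S T a b c) x c ∧
      ReflTransGen (fun p q => (a, p, q) ∈ glue S T a b c) b x := by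
  have h' : GlueData T S a c b := h.symm.rotate
  have hg : glue T S a c b = glue S T a b c := by rw [glue_rotate, glue_comm]
  rw [← hg]
  exact h'.link_apex_left hx

/-- The path from c to b in S and the path from b to c in T close up to one cycle. -/
theorem link_apex {x y x' y' : V} (hx : (a, x, y) ∈ glue S T a b c)
    (hx' : (a, x', y') ∈ glue S T a b c) :
    ReflTransGen (fun p q => (a, p, q) ∈ glue S T a b c) x x' := by
  have hbT : (a, c, b) ∈ T := h.right.rot h.mem_right
  have hcb := (h.link_apex_left h.mem_left).2
  have hbc := (h.link_apex_right hbT).2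
  have to_b : ReflTransGen (fun p q => (a, p, q) ∈ glue S T a b c) x b := by
    rcases mem_glue.1 hx with ⟨k, -⟩ | ⟨k, -⟩
    · exact (h.link_apex_left k).1
    · exact (h.link_apex_right k).1.trans hcb
  refine to_b.trans ?_
  rcases mem_glue.1 hx' with ⟨k, -⟩ | ⟨k, -⟩
  · exact hbc.trans (h.link_apex_left k).2
  · exact (h.link_apex_right k).2

/-- A vertex off the glued triangle belongs to one side only and keeps its link. -/
theorem link_other {v : V} (hva : v ≠ a) (hvb : v ≠ b) (hvc : v ≠ c) {x y x' y' : V}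
    (hx : (v, x, y) ∈ S) (hx' : (v, x', y') ∈ glue S T a b c) :
    ReflTransGen (fun p q => (v, p, q) ∈ glue S T a b c) x x' := by
  have hxS' : (v, x', y') ∈ S := by
    rcases mem_glue.1 hx' with ⟨k, -⟩ | ⟨k, -⟩
    · exact k
    · have := h.inter hx k
      tauto
  refine ReflTransGen.mono (fun p q hpq => mem_glue.2 (Or.inl ⟨hpq, ?_⟩)) _ _ (h.left.link hx hxS')
  rw [mem_triRot]
  tauto

/-- The connected sum of two oriented surfaces is an oriented surface. -/
theorem isOrientedSurface : IsOrientedSurface (glue S T a b c) where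
  rot {x y z} hx := by
    rw [mem_glue]
    rcases mem_glue.1 hx with ⟨k, k'⟩ | ⟨k, k'⟩
    · exact Or.inl ⟨h.left.rot k, triRot_rot.not.2 k'⟩
    · exact Or.inr ⟨h.right.rot k, triRot_rot.not.2 k'⟩
  asymm {x y z} hx hy := by
    rcases mem_glue.1 hx with ⟨k, k'⟩ | ⟨k, k'⟩ <;> rcases mem_glue.1 hy with ⟨l, l'⟩ | ⟨l, l'⟩
    · exact h.left.asymm k l
    · exact h.not_mem_swap k k' l
    · exact h.not_mem_swap l l' k
    · exact h.right.asymm k l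
  unique {x y z z'} hx hy := by
    rcases mem_glue.1 hx with ⟨k, k'⟩ | ⟨k, k'⟩ <;> rcases mem_glue.1 hy with ⟨l, l'⟩ | ⟨l, l'⟩
    · exact h.left.unique k l
    · exact ((h.inter_two k l).elim k' l').elim
    · exact ((h.inter_two l k).elim l' k').elim
    · exact h.right.unique k l
  opp {x y z} hx := by
    rcases mem_glue.1 hx with ⟨k, -⟩ | ⟨k, -⟩
    · exact h.opp_left k
    · rw [← glue_comm]
      exact h.symm.opp_left k
  link {v x y x' y'} hx hx' := by
    by_cases hva : v = a
    · subst hva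
      exact h.link_apex hx hx'
    by_cases hvb : v = b
    · subst hvb
      rw [← glue_rotate] at hx hx' ⊢
      exact h.rotate.link_apex hx hx'
    by_cases hvc : v = c
    · subst hvc
      rw [← glue_rotate, ← glue_rotate] at hx hx' ⊢
      exact h.rotate.rotate.link_apex hx hx'
    rcases mem_glue.1 hx with ⟨k, -⟩ | ⟨k, -⟩
    · exact h.link_other hva hvb hvc k hx'
    · rw [← glue_comm] at hx' ⊢
      exact h.symm.link_other hvb hva hvc k hx'
  connected {v x y w x' y'} hx hx' := by
    have haT := h.right.rot h.mem_right
    rcases mem_glue.1 hx with ⟨k, -⟩ | ⟨k, -⟩ <;> rcases mem_glue.1 hx' with ⟨l, -⟩ | ⟨l, -⟩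
    · exact h.reach_left k l
    · exact (h.reach_left k h.mem_left).trans (h.reach_right haT l)
    · exact (h.reach_right k haT).trans (h.reach_left h.mem_left l)
    · exact h.reach_right k l

theorem card_triRot_eq : (triRot a b c).card = 3 := by
  obtain ⟨h1, h2, h3⟩ := h.left.ne h.mem_left
  rw [triRot, Finset.card_eq_three.2 ⟨_, _, _, ?_, ?_, ?_, rfl⟩] <;> simp [h1, h2, h3, h1.symm]

theorem disjoint : Disjoint (S \ triRot a b c) (T \ triRot b a c) := by
  rw [Finset.disjoint_left]
  rintro ⟨x, y, z⟩ hx hy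
  rw [Finset.mem_sdiff] at hx hy
  exact (h.inter_two hx.1 hy.1).elim hx.2 hy.2

theorem card_glue_add : (glue S T a b c).card + 6 = S.card + T.card := by
  have h1 := triRot_subset h.left h.mem_left
  have h2 := triRot_subset h.right h.mem_right
  have k1 := Finset.card_sdiff_add_card_eq_card h1
  have k2 := Finset.card_sdiff_add_card_eq_card h2
  rw [h.card_triRot_eq] at k1
  rw [h.symm.card_triRot_eq] at k2
  rw [glue, Finset.card_union_of_disjoint h.disjoint]
  omega

end GlueData

end Glue

/-! ### Counting triangles over a given one. -/

section Degree

variable {V W U : Type*} [DecidableEq V] [DecidableEq W] [DecidableEq U]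

/-- The number of triples of `S` that `f` maps to the ordered triple `(p, q, r)`. -/
def fiberCount (S : Finset (V × V × V)) (f : V → U) (p q r : U) : ℤ :=
  ∑ t ∈ S, if f t.1 = p ∧ f t.2.1 = q ∧ f t.2.2 = r then 1 else 0

/-- The coefficient of `(p, q, r)` in the image under `f` of the fundamental cycle of `S`. -/
def pushCount (S : Finset (V × V × V)) (f : V → U) (p q r : U) : ℤ :=
  fiberCount S f p q r - fiberCount S f q p r

theorem pushforward_triSign [Fintype V] (S : Finset (V × V × V)) (f : V → U) (p q r : U) :
    pushforward f (triSign S) p q r = pushCount S f p q r := by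
  have key : ∀ p q, ∑ a, ∑ b, ∑ e, (if f a = p ∧ f b = q ∧ f e = r then
      (if (a, b, e) ∈ S then (1 : ℤ) else 0) else 0) = fiberCount S f p q r := by
    intro p q
    have hS : fiberCount S f p q r = ∑ t : V × V × V, if t ∈ S then
        (if f t.1 = p ∧ f t.2.1 = q ∧ f t.2.2 = r then (1 : ℤ) else 0) else 0 := by
      rw [Finset.sum_ite_mem, Finset.univ_inter, fiberCount]
    rw [hS, Fintype.sum_prod_type]
    refine Finset.sum_congr rfl fun a _ => ?_
    rw [Fintype.sum_prod_type]
    refine Finset.sum_congr rfl fun b _ => Finset.sum_congr rfl fun e _ => ?_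
    rw [← ite_and, ← ite_and]
    exact if_congr (by tauto) rfl rfl
  rw [pushCount, ← key, ← key, pushforward]
  -- The negative part of `triSign` tests the swapped triple, so its first two summation variables
  -- are exchanged.
  rw [Finset.sum_comm (f := fun a b => ∑ e, (if f a = q ∧ f b = p ∧ f e = r then
      (if (a, b, e) ∈ S then (1 : ℤ) else 0) else 0))]
  simp only [← Finset.sum_sub_distrib, triSign]
  refine Finset.sum_congr rfl fun a _ => Finset.sum_congr rfl fun b _ =>
    Finset.sum_congr rfl fun e _ => ?_
  by_cases h : f a = p ∧ f b = q ∧ f e = r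
  · have h' : f b = q ∧ f a = p ∧ f e = r := ⟨h.2.1, h.1, h.2.2⟩
    rw [if_pos h, if_pos h, if_pos h']
  · have h' : ¬ (f b = q ∧ f a = p ∧ f e = r) := fun k => h ⟨k.2.1, k.1, k.2.2⟩
    rw [if_neg h, if_neg h, if_neg h', sub_zero]

omit [DecidableEq W] in
theorem pushCount_mapTriples {j : W → V} (hj : Function.Injective j) (T : Finset (W × W × W))
    (f : V → U) (p q r : U) :
    pushCount (mapTriples j T) f p q r = pushCount T (f ∘ j) p q r := by
  simp only [pushCount, fiberCount, mapTriples, Function.comp_apply]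
  rw [Finset.sum_image (injective_mapTriple hj).injOn,
    Finset.sum_image (injective_mapTriple hj).injOn]

/-- The removed triangles are mirror images of each other, so their contributions cancel. -/
theorem GlueData.pushCount_glue {S T : Finset (V × V × V)} {a b c : V} (h : GlueData S T a b c)
    (f : V → U) (p q r : U) :
    pushCount (glue S T a b c) f p q r = pushCount S f p q r + pushCount T f p q r := by
  have h1 := triRot_subset h.left h.mem_left
  have h2 := triRot_subset h.right h.mem_right
  have hsum : ∀ p q, fiberCount (glue S T a b c) f p q r =
      fiberCount S f p q r - fiberCount (triRot a b c) f p q r +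
        (fiberCount T f p q r - fiberCount (triRot b a c) f p q r) := by
    intro p q
    simp only [fiberCount]
    rw [glue, Finset.sum_union h.disjoint, ← Finset.sum_sdiff h1, ← Finset.sum_sdiff h2]
    ring
  have hswap : ∀ p q, fiberCount (triRot b a c) f p q r = fiberCount (triRot a b c) f q p r := by
    intro p q
    simp only [fiberCount]
    refine Finset.sum_bij' (fun t _ => (t.2.1, t.1, t.2.2)) (fun t _ => (t.2.1, t.1, t.2.2))
      ?_ ?_ ?_ ?_ ?_
    · rintro ⟨x, y, z⟩ ht
      exact triRot_swap.2 ht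
    · rintro ⟨x, y, z⟩ ht
      exact triRot_swap.2 ht
    · intros; rfl
    · intros; rfl
    · rintro ⟨x, y, z⟩ ht
      exact if_congr (by tauto) rfl rfl
  simp only [pushCount, hsum, hswap]
  ring

end Degree

/-! ### A decidable test and the explicit tori. -/

section Check

variable {W : Type*} [DecidableEq W]

/-- In the link of `v`, the vertex `x'` is reached from `x` in at most `n` steps. -/
def linkReach (l : List (W × W × W)) (v x' : W) : ℕ → W → Bool
  | 0, x => decide (x = x')
  | n + 1, x => decide (x = x') ||
      l.any fun t => decide (t.1 = v ∧ t.2.1 = x) && linkReach l v x' n t.2.2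

theorem reflTransGen_of_linkReach {l : List (W × W × W)} {v x' : W} :
    ∀ {n : ℕ} {x : W}, linkReach l v x' n x = true →
      ReflTransGen (fun p q => (v, p, q) ∈ l) x x'
  | 0, x, h => by
    simp only [linkReach, decide_eq_true_eq] at h
    rw [h]
  | n + 1, x, h => by
    simp only [linkReach, Bool.or_eq_true, decide_eq_true_eq, List.any_eq_true,
      Bool.and_eq_true] at h
    rcases h with rfl | ⟨⟨v', y, z⟩, ht, ⟨rfl, rfl⟩, hz⟩
    · exact ReflTransGen.refl
    · exact (reflTransGen_of_linkReach hz).head ht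

/-- A test for oriented surfaces with a vertex `o` adjacent to all others and links of length at
most `n + 1`. -/
def surfaceCheck (l : List (W × W × W)) (n : ℕ) (o : W) : Bool :=
  l.all fun t => decide ((t.2.1, t.2.2, t.1) ∈ l) && decide ((t.2.1, t.1, t.2.2) ∉ l) &&
    (l.any fun t' => decide (t'.1 = t.2.1 ∧ t'.2.1 = t.1)) &&
    (decide (t.1 = o) || l.any fun t' => decide (t'.1 = t.1 ∧ t'.2.1 = o)) &&
    l.all fun t' => decide (t.1 ≠ t'.1) || (linkReach l t.1 t'.2.1 n t.2.1 &&
      decide (t.2.1 = t'.2.1 → t.2.2 = t'.2.2))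

theorem isOrientedSurface_of_check {l : List (W × W × W)} {n : ℕ} {o : W}
    (hc : surfaceCheck l n o = true) : IsOrientedSurface l.toFinset := by
  simp only [surfaceCheck, List.all_eq_true, Bool.and_eq_true, decide_eq_true_eq, List.any_eq_true,
    Bool.or_eq_true] at hc
  have hmem : ∀ {t}, t ∈ l.toFinset ↔ t ∈ l := List.mem_toFinset
  have hopp : ∀ {a b c}, (a, b, c) ∈ l.toFinset → ∃ d, (b, a, d) ∈ l.toFinset := by
    intro a b c h
    obtain ⟨⟨x, y, z⟩, ht, rfl, rfl⟩ := (hc _ (hmem.1 h)).1.1.2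
    exact ⟨z, hmem.2 ht⟩
  -- Any two vertices are joined through o.
  have hhub : ∀ {v x y}, (v, x, y) ∈ l.toFinset →
      ReflTransGen (fun p q => ∃ r, (p, q, r) ∈ l.toFinset) v o ∧
        ReflTransGen (fun p q => ∃ r, (p, q, r) ∈ l.toFinset) o v := by
    intro v x y h
    rcases (hc _ (hmem.1 h)).1.2 with rfl | ⟨⟨v', o', z⟩, ht, rfl, rfl⟩
    · exact ⟨ReflTransGen.refl, ReflTransGen.refl⟩
    · exact ⟨ReflTransGen.single ⟨z, hmem.2 ht⟩, ReflTransGen.single (hopp (hmem.2 ht))⟩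
  have hpair : ∀ {v x y x' y'}, (v, x, y) ∈ l → (v, x', y') ∈ l →
      linkReach l v x' n x = true ∧ (x = x' → y = y') := by
    intro v x y x' y' h h'
    exact ((hc _ h).2 _ h').resolve_left fun hn => hn rfl
  exact
    { rot := fun h => hmem.2 (hc _ (hmem.1 h)).1.1.1.1
      asymm := fun h h' => (hc _ (hmem.1 h)).1.1.1.2 (hmem.1 h')
      unique := fun h h' => (hpair (hmem.1 h) (hmem.1 h')).2 rfl
      opp := hopp
      link := fun h h' => ReflTransGen.mono (fun _ _ hpq => hmem.2 hpq) _ _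
        (reflTransGen_of_linkReach (hpair (hmem.1 h) (hmem.1 h')).1)
      connected := fun h h' => (hhub h).1.trans (hhub h').2 }

/-- All rotations of the given triples. -/
def rotations (l : List (W × W × W)) : List (W × W × W) :=
  l ++ l.map (fun t => (t.2.1, t.2.2, t.1)) ++ l.map (fun t => (t.2.2, t.1, t.2.1))

end Check

/-- The positively oriented triangles of the `7`-vertex torus. -/
def torusList : List (Fin 7 × Fin 7 × Fin 7) :=
  rotations [(0, 1, 3), (1, 2, 4), (2, 3, 5), (3, 4, 6), (4, 5, 0), (5, 6, 1), (6, 0, 2), (0, 3, 2),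
    (1, 4, 3), (2, 5, 4), (3, 6, 5), (4, 0, 6), (5, 1, 0), (6, 2, 1)]

/-- The mirror image of the torus, with vertices `2` and `3` exchanged. -/
def mirrorList : List (Fin 7 × Fin 7 × Fin 7) :=
  rotations [(1, 0, 2), (3, 1, 4), (2, 3, 5), (4, 2, 6), (5, 4, 0), (6, 5, 1), (0, 6, 3), (2, 0, 3),
    (4, 1, 2), (5, 3, 4), (6, 2, 5), (0, 4, 6), (1, 5, 0), (3, 6, 1)]

/-- The collapse of the mirrored torus onto a triangle. -/
def collapseMap : Fin 7 → Fin 7 := ![0, 1, 3, 0, 0, 0, 0]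

/-- The torus with two stellar subdivisions in the triangle `(0, 1, 3)`, which create a triangle that
the subdivision map reverses. The vertices are numbered such that it is `(1, 0, 2)`. -/
def subdividedList : List (Fin 9 × Fin 9 × Fin 9) :=
  rotations [(1, 4, 6), (4, 5, 7), (5, 6, 8), (6, 7, 3), (7, 8, 1), (8, 3, 4), (3, 5, 4), (1, 6, 5),
    (4, 7, 6), (5, 8, 7), (6, 3, 8), (7, 1, 3), (8, 4, 1), (0, 1, 5), (3, 0, 5), (3, 1, 2),
    (1, 0, 2), (0, 3, 2)]

/-- The simplicial map from the subdivided torus to the torus. -/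
def subdivisionMap : Fin 9 → Fin 7 := ![0, 1, 3, 0, 2, 3, 4, 5, 6]

/-- The positively oriented triangles of the `7`-vertex torus. -/
def torusTriples : Finset (Fin 7 × Fin 7 × Fin 7) := torusList.toFinset

/-- The positively oriented triangles of the mirrored torus. -/
def mirrorTriples : Finset (Fin 7 × Fin 7 × Fin 7) := mirrorList.toFinset

/-- The positively oriented triangles of the subdivided torus. -/
def subdividedTriples : Finset (Fin 9 × Fin 9 × Fin 9) := subdividedList.toFinset

theorem nodup_torusList : torusList.Nodup := by decide +kernel

theorem nodup_mirrorList : mirrorList.Nodup := by decide +kernel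

theorem nodup_subdividedList : subdividedList.Nodup := by decide +kernel

theorem isOrientedSurface_torusTriples : IsOrientedSurface torusTriples :=
  isOrientedSurface_of_check (n := 6) (o := 0) (by decide +kernel)

theorem isOrientedSurface_mirrorTriples : IsOrientedSurface mirrorTriples :=
  isOrientedSurface_of_check (n := 6) (o := 0) (by decide +kernel)

theorem isOrientedSurface_subdividedTriples : IsOrientedSurface subdividedTriples :=
  -- Vertex 1 is an end of both subdivided triangles and hence adjacent to the eight others; 8 is
  -- also the length of its link.
  isOrientedSurface_of_check (n := 8) (o := 1) (by decide +kernel)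

theorem cover_of_check {W : Type*} [DecidableEq W] {l : List (W × W × W)}
    (hc : ∀ v, (l.any fun t => decide (t.1 = v)) = true) :
    ∀ v, ∃ x y, (v, x, y) ∈ l.toFinset := by
  intro v
  have hv := hc v
  simp only [List.any_eq_true, decide_eq_true_eq] at hv
  obtain ⟨⟨v', x, y⟩, ht, rfl⟩ := hv
  exact ⟨x, y, List.mem_toFinset.2 ht⟩

theorem torusTriples_cover : ∀ v, ∃ x y, (v, x, y) ∈ torusTriples :=
  cover_of_check (by decide +kernel)

theorem complexOf_torusTriples : complexOf torusTriples torusTriples_cover = torus := by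
  have h1 : ∀ t ∈ torusList, ({t.1, t.2.1, t.2.2} : Finset (Fin 7)) ∈ torusTriangles := by
    rw [← List.forall_iff_forall_mem]
    decide +kernel
  have h2 : ∀ s ∈ torusTriangles, s ∈ torusList.map
      fun t => ({t.1, t.2.1, t.2.2} : Finset (Fin 7)) := by
    unfold torusTriangles
    simp only [Finset.forall_mem_insert, Finset.mem_singleton, forall_eq]
    decide +kernel
  have hf : (complexOf torusTriples torusTriples_cover).faces = torus.faces := by
    ext s
    constructor
    · rintro ⟨hs, a, b, c, ht, hsub⟩
      exact ⟨hs, _, h1 _ (List.mem_toFinset.1 ht), hsub⟩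
    · rintro ⟨hs, t, ht, hsub⟩
      obtain ⟨⟨a, b, c⟩, hS, rfl⟩ := List.mem_map.1 (h2 t ht)
      exact ⟨hs, a, b, c, List.mem_toFinset.2 hS, hsub⟩
  exact AbstractSimplicialComplex.ext hf

/-- The number of triples of the list that `f` maps to `(p, q, r)`. -/
def listCount {W U : Type*} [DecidableEq U] (l : List (W × W × W)) (f : W → U) (p q r : U) : ℤ :=
  (l.map fun t => if f t.1 = p ∧ f t.2.1 = q ∧ f t.2.2 = r then (1 : ℤ) else 0).sum

theorem pushCount_toFinset {W U : Type*} [DecidableEq W] [DecidableEq U] {l : List (W × W × W)}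
    (hl : l.Nodup) (f : W → U) (p q r : U) :
    pushCount l.toFinset f p q r = listCount l f p q r - listCount l f q p r := by
  rw [pushCount, fiberCount, fiberCount, List.sum_toFinset _ hl, List.sum_toFinset _ hl]
  rfl

theorem triSign_torusTriples (p q r : Fin 7) : triSign torusTriples p q r =
    (if (p, q, r) ∈ torusList then 1 else 0) - (if (q, p, r) ∈ torusList then 1 else 0) := by
  simp [triSign, torusTriples]

/-- Only the two triangles on the edge between 1 and 2 are not degenerated by the collapse, and they
cover (0, 1, 3) with opposite signs. -/
theorem pushCount_collapse (p q r : Fin 7) :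
    pushCount mirrorTriples collapseMap p q r = 0 * triSign torusTriples p q r := by
  rw [mirrorTriples, pushCount_toFinset nodup_mirrorList, zero_mul]
  revert p q r
  decide +kernel

/-- Of the five pieces of the subdivided triangle, (0, 1, 5) and (3, 1, 2) count positively over (0,
1, 3), (1, 0, 2) counts negatively and two degenerate. All other triangles map isomorphically. -/
theorem pushCount_subdivision (p q r : Fin 7) :
    pushCount subdividedTriples subdivisionMap p q r = 1 * triSign torusTriples p q r := by
  rw [subdividedTriples, pushCount_toFinset nodup_subdividedList, triSign_torusTriples, one_mul]
  revert p q r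
  decide +kernel

theorem pushCount_torus (p q r : Fin 7) :
    pushCount torusTriples id p q r = 1 * triSign torusTriples p q r := by
  rw [torusTriples, pushCount_toFinset nodup_torusList, ← torusTriples, triSign_torusTriples,
    one_mul]
  revert p q r
  decide +kernel

/-! ### Attaching summands and the induction. -/

/-- A triangulated oriented surface of genus `g` with `4 g + 2 n + 1` vertices, together with a
simplicial map of degree `n` to the torus that maps some triangle positively onto `(0, 1, 3)`. -/
structure IsTorusMap {V : Type*} [Fintype V] [DecidableEq V] (g n : ℕ) (S : Finset (V × V × V))
    (f : V → Fin 7) : Prop where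
  surface : IsOrientedSurface S
  cover : ∀ v, ∃ x y, (v, x, y) ∈ S
  card_vertices : Fintype.card V = 4 * g + 2 * n + 1
  card_triples : S.card + 12 = 6 * (Fintype.card V + 2 * g)
  simplicial : ∀ a b c, (a, b, c) ∈ S → ∃ x y z, (x, y, z) ∈ torusTriples ∧
    ({f a, f b, f c} : Finset (Fin 7)) ⊆ {x, y, z}
  degree : ∀ p q r, pushCount S f p q r = n * triSign torusTriples p q r
  pos : ∃ a b c, (a, b, c) ∈ S ∧ f a = 0 ∧ f b = 1 ∧ f c = 3

/-- A torus with `k + 3` vertices and a map of degree `e` to the `7`-vertex torus, which can be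
attached to an `IsTorusMap` along the triangle on its first three vertices. -/
structure IsSummand (k e : ℕ) (T : Finset (Fin (3 + k) × Fin (3 + k) × Fin (3 + k)))
    (f : Fin (3 + k) → Fin 7) : Prop where
  surface : IsOrientedSurface T
  cover : ∀ v, ∃ x y, (v, x, y) ∈ T
  card_new : k = 4 + 2 * e
  card_triples : T.card = 6 * (3 + k)
  simplicial : ∀ a b c, (a, b, c) ∈ T → ∃ x y z, (x, y, z) ∈ torusTriples ∧
    ({f a, f b, f c} : Finset (Fin 7)) ⊆ {x, y, z}
  degree : ∀ p q r, pushCount T f p q r = e * triSign torusTriples p q r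
  pos : ∃ a b c, (a, b, c) ∈ T ∧ f a = 0 ∧ f b = 1 ∧ f c = 3
  base : (Fin.castAdd k 1, Fin.castAdd k 0, Fin.castAdd k 2) ∈ T
  base_zero : f (Fin.castAdd k 0) = 0
  base_one : f (Fin.castAdd k 1) = 1
  base_two : f (Fin.castAdd k 2) = 3

theorem IsTorusMap.attach {V : Type*} [Fintype V] [DecidableEq V] {g n : ℕ}
    {S : Finset (V × V × V)} {f : V → Fin 7} (h : IsTorusMap g n S f) {k e : ℕ}
    {T : Finset (Fin (3 + k) × Fin (3 + k) × Fin (3 + k))} {f' : Fin (3 + k) → Fin 7}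
    (h' : IsSummand k e T f') :
    ∃ (R : Finset ((V ⊕ Fin k) × (V ⊕ Fin k) × (V ⊕ Fin k))) (F : V ⊕ Fin k → Fin 7),
      IsTorusMap (g + 1) (n + e) R F := by
  obtain ⟨a, b, c, hS, fa, fb, fc⟩ := h.pos
  obtain ⟨hab, hac, hbc⟩ := h.surface.ne hS
  -- The first three vertices of the summand are identified with a, b, c; its other k vertices are
  -- new.
  let j : Fin (3 + k) → V ⊕ Fin k := Fin.addCases (fun i => Sum.inl (![a, b, c] i)) Sum.inr
  let F : V ⊕ Fin k → Fin 7 := Sum.elim f fun i => f' (Fin.natAdd 3 i)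
  have j0 : j (Fin.castAdd k 0) = Sum.inl a := by simp [j]
  have j1 : j (Fin.castAdd k 1) = Sum.inl b := by simp [j]
  have j2 : j (Fin.castAdd k 2) = Sum.inl c := by simp [j]
  have jr : ∀ i, j (Fin.natAdd 3 i) = Sum.inr i := fun i => by simp [j]
  have hFj : F ∘ j = f' := by
    ext1 i
    induction i using Fin.addCases with
    | left i =>
      fin_cases i
      · exact (congrArg F j0).trans (fa.trans h'.base_zero.symm)
      · exact (congrArg F j1).trans (fb.trans h'.base_one.symm)
      · exact (congrArg F j2).trans (fc.trans h'.base_two.symm)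
    | right i => exact congrArg F (jr i)
  have hFj' : ∀ i, F (j i) = f' i := congrFun hFj
  have hvec : Function.Injective ![a, b, c] := by
    intro x y hxy
    fin_cases x <;> fin_cases y <;> simp_all
  have hj : Function.Injective j := by
    intro x y hxy
    induction x using Fin.addCases with
    | left x =>
      induction y using Fin.addCases with
      | left y =>
        simp only [j, Fin.addCases_left, Sum.inl.injEq] at hxy
        rw [hvec hxy]
      | right y => simp [j] at hxy
    | right x =>
      induction y using Fin.addCases with
      | left y => simp [j] at hxy
      | right y =>
        simp only [j, Fin.addCases_right, Sum.inr.injEq] at hxy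
        rw [hxy]
  have hinl : Function.Injective (Sum.inl : V → V ⊕ Fin k) := Sum.inl_injective
  have hG : GlueData (mapTriples Sum.inl S) (mapTriples j T) (Sum.inl a) (Sum.inl b)
      (Sum.inl c : V ⊕ Fin k) :=
    { left := h.surface.map hinl
      right := h'.surface.map hj
      mem_left := mem_mapTriples_of_mem hS
      mem_right := by
        rw [← j0, ← j1, ← j2]
        exact mem_mapTriples_of_mem h'.base
      inter := by
        intro v x y x' y' h1 h2
        obtain ⟨v₁, -, -, -, rfl, -⟩ := mem_mapTriples.1 h1
        obtain ⟨i, -, -, -, hi, -⟩ := mem_mapTriples.1 h2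
        induction i using Fin.addCases with
        | left i =>
          rw [← hi]
          fin_cases i
          · exact Or.inl j0
          · exact Or.inr (Or.inl j1)
          · exact Or.inr (Or.inr j2)
        | right i =>
          rw [jr] at hi
          exact absurd hi (by simp) }
  have hcardS : (mapTriples (Sum.inl : V → V ⊕ Fin k) S).card = S.card :=
    Finset.card_image_of_injective _ (injective_mapTriple hinl)
  have hcardT : (mapTriples j T).card = T.card :=
    Finset.card_image_of_injective _ (injective_mapTriple hj)
  have hV : Fintype.card (V ⊕ Fin k) = Fintype.card V + k := by simp
  refine ⟨glue (mapTriples Sum.inl S) (mapTriples j T) (Sum.inl a) (Sum.inl b) (Sum.inl c), F,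
    hG.isOrientedSurface, ?_, ?_, ?_, ?_, ?_, ?_⟩
  · rintro (v | i)
    · obtain ⟨x, y, hv⟩ := h.cover v
      obtain ⟨z, hz⟩ := hG.adj_of_left (mem_mapTriples_of_mem hv)
      exact ⟨_, z, hz⟩
    · obtain ⟨x, y, hv⟩ := h'.cover (Fin.natAdd 3 i)
      obtain ⟨z, hz⟩ := hG.symm.adj_of_left (mem_mapTriples_of_mem hv)
      rw [jr, GlueData.glue_comm] at hz
      exact ⟨_, z, hz⟩
  · have := h.card_vertices
    have := h'.card_new
    omega
  · have h1 := hG.card_glue_add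
    have := h.card_triples
    have := h'.card_triples
    omega
  · intro x y z hx
    rcases mem_glue.1 hx with ⟨hx, -⟩ | ⟨hx, -⟩
    · obtain ⟨x, y, z, hm, rfl, rfl, rfl⟩ := mem_mapTriples.1 hx
      exact h.simplicial x y z hm
    · obtain ⟨x, y, z, hm, rfl, rfl, rfl⟩ := mem_mapTriples.1 hx
      rw [hFj', hFj', hFj']
      exact h'.simplicial x y z hm
  · intro p q r
    have hl : F ∘ Sum.inl = f := Sum.elim_comp_inl _ _
    rw [hG.pushCount_glue, pushCount_mapTriples hinl, pushCount_mapTriples hj, hFj, hl, h.degree,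
      h'.degree]
    push_cast
    ring
  · obtain ⟨x, y, z, hT, hx, hy, hz⟩ := h'.pos
    -- The positive triangle for the next step comes from the summand. It survives because it maps
    -- to (0, 1, 3), whereas the removed rotations of (b, a, c) map to rotations of (1, 0, 3).
    refine ⟨j x, j y, j z, mem_glue.2 (Or.inr ⟨mem_mapTriples_of_mem hT, fun hm => ?_⟩),
      (hFj' x).trans hx, (hFj' y).trans hy, (hFj' z).trans hz⟩
    have ha : F (Sum.inl a) = 0 := fa
    have hb : F (Sum.inl b) = 1 := fb
    have hc : F (Sum.inl c) = 3 := fc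
    have hxF := (hFj' x).trans hx
    rcases mem_triRot.1 hm with ⟨k1, k2, -⟩ | ⟨k1, k2, -⟩ | ⟨k1, k2, -⟩
    · rw [k1, hb] at hxF
      exact absurd hxF (by decide)
    · have hyF := (hFj' y).trans hy
      rw [k2, hc] at hyF
      exact absurd hyF (by decide)
    · rw [k1, hc] at hxF
      exact absurd hxF (by decide)

/-- A test for simplicial maps from a list of triangles to the torus. -/
theorem simplicial_of_check {W : Type*} [DecidableEq W] {l : List (W × W × W)} {f : W → Fin 7}
    (hc : (l.all fun t => torusList.any fun s => decide
      (({f t.1, f t.2.1, f t.2.2} : Finset (Fin 7)) ⊆ {s.1, s.2.1, s.2.2})) = true) :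
    ∀ a b c, (a, b, c) ∈ l.toFinset → ∃ x y z, (x, y, z) ∈ torusTriples ∧
      ({f a, f b, f c} : Finset (Fin 7)) ⊆ {x, y, z} := by
  simp only [List.all_eq_true, List.any_eq_true, decide_eq_true_eq] at hc
  intro a b c h
  obtain ⟨⟨x, y, z⟩, hs, hsub⟩ := hc _ (List.mem_toFinset.1 h)
  exact ⟨x, y, z, List.mem_toFinset.2 hs, hsub⟩

theorem isTorusMap_id : IsTorusMap 1 1 torusTriples id where
  surface := isOrientedSurface_torusTriples
  cover := torusTriples_cover
  card_vertices := rfl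
  card_triples := by
    rw [torusTriples, List.toFinset_card_of_nodup nodup_torusList]
    rfl
  simplicial a b c h := ⟨a, b, c, h, subset_rfl⟩
  degree := pushCount_torus
  pos := ⟨0, 1, 3, List.mem_toFinset.2 (by decide +kernel), rfl, rfl, rfl⟩

theorem isSummand_mirror : IsSummand 4 0 mirrorTriples collapseMap where
  surface := isOrientedSurface_mirrorTriples
  cover := cover_of_check (by decide +kernel)
  card_new := rfl
  card_triples := (List.toFinset_card_of_nodup nodup_mirrorList).trans rfl
  simplicial := simplicial_of_check (by decide +kernel)
  degree := pushCount_collapse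
  pos := ⟨4, 1, 2, List.mem_toFinset.2 (by decide +kernel), rfl, rfl, rfl⟩
  base := List.mem_toFinset.2 (by decide +kernel)
  base_zero := rfl
  base_one := rfl
  base_two := rfl

theorem isSummand_subdivided : IsSummand 6 1 subdividedTriples subdivisionMap where
  surface := isOrientedSurface_subdividedTriples
  cover := cover_of_check (by decide +kernel)
  card_new := rfl
  card_triples := (List.toFinset_card_of_nodup nodup_subdividedList).trans rfl
  simplicial := simplicial_of_check (by decide +kernel)
  degree := pushCount_subdivision
  pos := ⟨0, 1, 5, List.mem_toFinset.2 (by decide +kernel), rfl, rfl, rfl⟩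
  base := List.mem_toFinset.2 (by decide +kernel)
  base_zero := rfl
  base_one := rfl
  base_two := rfl

/-- Every degree `n + 1` is realized on a surface of genus `n + 1 + m`. -/
theorem exists_isTorusMap (n m : ℕ) : ∃ (V : Type) (_ : Fintype V) (_ : DecidableEq V)
    (S : Finset (V × V × V)) (f : V → Fin 7), IsTorusMap (n + 1 + m) (n + 1) S f := by
  -- The outer induction attaches the m summands of degree 0, the inner one the n summands of degree
  -- 1.
  induction m with
  | zero =>
    induction n with
    | zero => exact ⟨Fin 7, inferInstance, inferInstance, _, _, isTorusMap_id⟩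
    | succ n ih =>
      obtain ⟨V, _, _, S, f, h⟩ := ih
      obtain ⟨R, F, hR⟩ := h.attach isSummand_subdivided
      exact ⟨V ⊕ Fin 6, inferInstance, inferInstance, R, F, hR⟩
  | succ m ih =>
    obtain ⟨V, _, _, S, f, h⟩ := ih
    obtain ⟨R, F, hR⟩ := h.attach isSummand_mirror
    exact ⟨V ⊕ Fin 4, inferInstance, inferInstance, R, F, hR⟩

/-! ### Orientation reversal and the final assembly. -/

/-- The opposite orientation. -/
def CoherentOrientation.reverse {V : Type*} [DecidableEq V] {K : AbstractSimplicialComplex V}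
    (o : CoherentOrientation K) : CoherentOrientation K where
  sign a b c := - o.sign a b c
  swap_left a b c := by rw [o.swap_left]
  swap_right a b c := by rw [o.swap_right]
  sign_of_triangle a b c h := by
    rcases o.sign_of_triangle a b c h with k | k <;> simp [k]
  sign_of_not_triangle a b c h := by rw [o.sign_of_not_triangle a b c h, neg_zero]
  coherent a b c c' h h' hne := by rw [o.coherent a b c c' h h' hne]

theorem HasDegree.reverse {V W : Type*} [Fintype V] [DecidableEq V] [DecidableEq W]
    {K : AbstractSimplicialComplex V} {L : AbstractSimplicialComplex W}
    {oK : CoherentOrientation K} {oL : CoherentOrientation L} {f : V → W} {d : ℤ}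
    (h : HasDegree oK oL f d) : HasDegree oK.reverse oL f (-d) := by
  intro p q r
  rw [neg_mul, ← h p q r]
  simp only [pushforward, CoherentOrientation.reverse, ← Finset.sum_neg_distrib]
  refine Finset.sum_congr rfl fun a _ => Finset.sum_congr rfl fun b _ =>
    Finset.sum_congr rfl fun e _ => ?_
  split_ifs <;> simp

/-- The orientation of the torus in which `(0, 1, 3)` is positive. -/
theorem exists_torus_orientation :
    ∃ o : CoherentOrientation torus, o.sign = triSign torusTriples := by
  rw [← complexOf_torusTriples]
  exact ⟨orientationOf isOrientedSurface_torusTriples, rfl⟩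

theorem isTriangulatedSurface_torus : IsTriangulatedSurface torus 1 := by
  rw [← complexOf_torusTriples]
  refine isTriangulatedSurface_complexOf isOrientedSurface_torusTriples ?_
  have := isTorusMap_id.card_triples
  omega

theorem IsTorusMap.isSimplicialMap {V : Type*} [Fintype V] [DecidableEq V] {g n : ℕ}
    {S : Finset (V × V × V)} {f : V → Fin 7} (h : IsTorusMap g n S f) :
    IsSimplicialMap (complexOf S h.cover) torus f := by
  rw [← complexOf_torusTriples]
  rintro s ⟨hs, a, b, c, hS, hsub⟩
  obtain ⟨x, y, z, hT, hxyz⟩ := h.simplicial a b c hS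
  refine ⟨hs.image f, x, y, z, hT, (Finset.image_subset_image hsub).trans ?_⟩
  simpa only [Finset.image_insert, Finset.image_singleton] using hxyz

end TriSurf

theorem theorem3p5 (g i : ℕ) (hg : 2 ≤ g) (hi : 1 ≤ i) (hig : i ≤ g - 1)
    (d : ℤ) (hd : |d| = (g : ℤ) - (i : ℤ)) :
    TriSurf.IsTriangulatedSurface TriSurf.torus 1 ∧
    ∃ (V : Type) (_ : Fintype V) (_ : DecidableEq V) (K : AbstractSimplicialComplex V)
      (oK : TriSurf.CoherentOrientation K) (oT : TriSurf.CoherentOrientation TriSurf.torus)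
      (f : V → Fin 7),
      (Fintype.card V : ℤ) = 6 * (g : ℤ) - 2 * (i : ℤ) + 1 ∧
      TriSurf.IsTriangulatedSurface K g ∧
      oT.sign 0 1 3 = 1 ∧
      TriSurf.IsSimplicialMap K TriSurf.torus f ∧
      TriSurf.HasDegree oK oT f d := by
  refine ⟨TriSurf.isTriangulatedSurface_torus, ?_⟩
  -- The absolute degree g - i is n + 1, which is positive since i ≤ g - 1.
  obtain ⟨n, hn⟩ : ∃ n, n + 1 + i = g := ⟨g - i - 1, by omega⟩
  obtain ⟨V, _, _, S, f, h⟩ := TriSurf.exists_isTorusMap n i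
  rw [hn] at h
  obtain ⟨oT, hoT⟩ := TriSurf.exists_torus_orientation
  have hcard := h.card_vertices
  have : Nonempty V := Fintype.card_pos_iff.1 (by omega)
  have hsurf : TriSurf.IsTriangulatedSurface (TriSurf.complexOf S h.cover) g := by
    refine TriSurf.isTriangulatedSurface_complexOf h.surface ?_
    have := h.card_triples
    omega
  have hdeg : TriSurf.HasDegree (TriSurf.orientationOf (hcov := h.cover) h.surface) oT f
      ((n + 1 : ℕ) : ℤ) := by
    intro p q r
    rw [hoT, ← h.degree p q r]
    exact TriSurf.pushforward_triSign S f p q r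
  have hpos : oT.sign 0 1 3 = 1 := by
    rw [hoT, TriSurf.triSign_torusTriples]
    decide +kernel
  have hcard' : (Fintype.card V : ℤ) = 6 * (g : ℤ) - 2 * (i : ℤ) + 1 := by omega
  rcases abs_choice d with hd' | hd'
  · have hdn : d = ((n + 1 : ℕ) : ℤ) := by omega
    exact ⟨V, _, _, _, TriSurf.orientationOf h.surface, oT, f, hcard', hsurf, hpos,
      h.isSimplicialMap, hdn ▸ hdeg⟩
  · have hdn : d = -((n + 1 : ℕ) : ℤ) := by omega
    exact ⟨V, _, _, _, (TriSurf.orientationOf h.surface).reverse, oT, f, hcard', hsurf, hpos,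
      h.isSimplicialMap, hdn ▸ hdeg.reverse⟩
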